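/- **Notation.** For distinct points $\alpha=(\alpha_1,\dots,\alpha_n)$ of a finite field $\mathbb F_q$, let $\mathrm{RS}_{n,k}(\alpha)=\{(f(\alpha_1),\dots,f(\alpha_n)) : f\in\mathbb F_q[x],\ \deg f<k\}$. The $t$-permutation-insdel adversary permutes the coordinates of a codeword arbitrarily and then performs up to $t$ single-symbol insertions and deletions; a code is *robust* against it if the adversary can never produce the same output from two distinct codewords. A *fully anonymous $(t,r,n)$ ramp scheme* ($t<r\le n$) with secrets in $\mathbb F_q$ and shares in a finite set $\Omega$ is a randomized map $\mathrm{Share}:\mathbb F_q\to\Omega^n$ such that (i) for every secret $s$, every $m\le t$, every sequence $I$ of $m$ distinct elements of $[n]$ and every $v\in\Omega^m$, $\Pr[\mathrm{Share}(s)_I=v]=|\Omega|^{-m}$; and (ii) there is a function $\mathrm{Recon}:\Omega^r\to\mathbb F_q$ such that $\mathrm{Recon}(\mathrm{sh}_I)=s$ for every $s$, every possible output $\mathrm{sh}$ of $\mathrm{Share}(s)$ and every sequence $I$ of $r$ distinct elements of $[n]$. The *Shamir scheme* with points $\alpha$ draws a uniformly random $f\in\mathbb F_q[x]$ with $\deg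 f<k$ and $f(0)=s$ and gives participant $i$ the share $f(\alpha_i)$ only. For $k,e,n\ge 1$, a *power construction with exponent $e$* consists of a prime $p>k^2e$ with $p\ge n$, an extension $\mathbb F_q=\mathbb F_p(\gamma)$ of $\mathbb F_p$ of degree $k^2e$, and the points $\alpha_i=(\gamma-i)^{e}$, $1\le i\le n$. Put $\ell=((2k)!)^2$. **Theorem.** 1. Let $k\ge1$ and $2k-1\le n$. For every power construction with exponent $\ell$, the field has size $q=p^{k^2\ell}$, the points $\alpha_1,\dots,\alpha_n$ are distinct and nonzero, $\mathrm{RS}_{n,k}(\alpha)$ is robust against the $(n-2k+1)$-permutation-insdel adversary, and the Shamir scheme with points $\alpha$ is a fully anonymous $(k-1,2k-1,n)$ ramp scheme with secrets and shares in $\mathbb F_q$. 2. There is an absolute constant $c$ such that for all integers $A\ge 0$, $k\ge1$ and $n\ge2$ with $2k-1\le n$ and $k^2\ell\le n^{A}$ there is a power construction with exponent $\ell$ over a field of size $q\le n^{cA\,k^2\ell}$. (So for $k^2\ell\le n^{O(1)}$ the field has size $n^{O(k^2((2k)!)^2)}$.) 3. There is an absolute constant $c$ such that for all $k\ge1$ and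 $n\ge2$ with $2k-1\le n$ there are an exponent $e\le\ell$ and a power construction with exponent $e$ over a field of size $q\le n^{c\,k^2((2k)!)^2}$ whose points are distinct and nonzero, whose code $\mathrm{RS}_{n,k}(\alpha)$ is robust against the $(n-2k+1)$-permutation-insdel adversary, and whose Shamir scheme is a fully anonymous $(k-1,2k-1,n)$ ramp scheme with secrets and shares in $\mathbb F_q$. -/

import Mathlib

open Polynomial
open scoped ENNReal Nat IntermediateField

/-- The Reed–Solomon code of dimension `k` with evaluation points `α`. -/
def rsCode {F : Type*} [Field F] {n : ℕ} (k : ℕ) (α : Fin n → F) : Set (Fin n → F) :=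
  {c | ∃ f : F[X], f.degree < (k : WithBot ℕ) ∧ c = fun i => f.eval (α i)}

/-- A single insertion or deletion of one symbol, at an arbitrary place of a string. -/
inductive InsdelStep {A : Type*} : List A → List A → Prop
  | deletion (u v : List A) (a : A) : InsdelStep (u ++ a :: v) (u ++ v)
  | insertion (u v : List A) (a : A) : InsdelStep (u ++ v) (u ++ a :: v)

/-- `InsdelErrors m s w`: the string `w` arises from `s` by exactly `m` successive insdel errors. -/
def InsdelErrors {A : Type*} : ℕ → List A → List A → Prop
  | 0, s, w => s = w
  | m + 1, s, w => ∃ u, InsdelStep s u ∧ InsdelErrors m u w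

/-- The possible outputs of the `t`-permutation-insdel adversary on `c`: it permutes the symbols
of `c` arbitrarily and then performs up to `t` insdel errors. -/
def adversaryOutputs {A : Type*} {n : ℕ} (t : ℕ) (c : Fin n → A) : Set (List A) :=
  {w | ∃ π : Equiv.Perm (Fin n), ∃ m ≤ t, InsdelErrors m (List.ofFn fun i => c (π i)) w}

/-- Robustness against the `t`-permutation-insdel adversary: it cannot produce the same output on
two distinct codewords. -/
def RobustPermInsdel {A : Type*} {n : ℕ} (t : ℕ) (C : Set (Fin n → A)) : Prop :=
  ∀ c ∈ C, ∀ c' ∈ C, c ≠ c' → Disjoint (adversaryOutputs t c) (adversaryOutputs t c')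

/-- `Share`, a randomized map from secrets in `S` to vectors of `n` shares in the common finite
share domain `Ω`, is a fully anonymous `(t, r, n)` ramp secret-sharing scheme. -/
structure IsFullyAnonymousRamp {S Ω : Type*} [Fintype Ω] (t r n : ℕ)
    (Share : S → PMF (Fin n → Ω)) : Prop where
  gap : t < r
  threshold_le : r ≤ n
  share_anonymity : ∀ (s : S) (m : ℕ), m ≤ t → ∀ I : Fin m → Fin n, Function.Injective I →
    ∀ v : Fin m → Ω,
      (Share s).toOuterMeasure {sh | (fun j => sh (I j)) = v} = ((Fintype.card Ω : ℝ≥0∞)⁻¹) ^ m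
  anonymous_recon : ∃ Recon : (Fin r → Ω) → S, ∀ (s : S) (I : Fin r → Fin n),
    Function.Injective I → ∀ sh ∈ (Share s).support, Recon (fun j => sh (I j)) = s

/-- Identity-free Shamir sharing: for a secret `s`, draw a uniformly random polynomial `f` with
`deg f < k` and `f(0) = s` (that is, draw its `k - 1` non-constant coefficients uniformly), and
give participant `i` the share `f (α i)`. -/
noncomputable def shamirShare {F : Type*} [Field F] [Fintype F] {n : ℕ} (k : ℕ) (α : Fin n → F)
    (s : F) : PMF (Fin n → F) :=
  (PMF.uniformOfFintype (Fin (k - 1) → F)).map fun a i =>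
    (C s + ∑ j : Fin (k - 1), C (a j) * X ^ ((j : ℕ) + 1)).eval (α i)

/-- The exponent `ℓ = ((2k)!)²`. -/
def ell (k : ℕ) : ℕ := ((2 * k)!) ^ 2

/-- The evaluation points `(γ - i) ^ e`, for `1 ≤ i ≤ n`. -/
def powPoints {F : Type*} [Field F] (γ : F) (e n : ℕ) : Fin n → F :=
  fun i => (γ - (((i : ℕ) + 1 : ℕ) : F)) ^ e

/-- The parameters of the power construction with exponent `e`: a prime `p > k² e` with `n ≤ p`,
and an extension `F = 𝔽_p(γ)` of degree `k² e`. -/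
structure IsPowConstruction (k e n p : ℕ) [Fact p.Prime] (F : Type*) [Field F]
    [Algebra (ZMod p) F] (γ : F) : Prop where
  lt_prime : k ^ 2 * e < p
  le_prime : n ≤ p
  finrank_eq : Module.finrank (ZMod p) F = k ^ 2 * e
  adjoin_eq : (ZMod p)⟮γ⟯ = ⊤

/-!
Everything reduces to the following separation property: if `f`, `g` have degree less than `k` and
`f (α (I j)) = g (α (J j))` for `2k - 1` indices `j`, with `I` and `J` injective, then `f = g`.
Indeed, after `n - 2k + 1` insdel errors at least `2k - 1` symbols of each permuted codeword survive
in a common output, and `2k - 1` unlabelled shares determine the secret.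

Read `j` as an edge from `I j` to `J j`. If the edges contain `k` disjoint cycles, summing `f - g`
over each cycle gives `0`, so the coefficients of `f - g` solve a linear system whose matrix
consists of power sums; collapsing each cycle to a point turns its determinant into a nonzero
multiple of a Vandermonde determinant. If they do not, the coefficients of `f` and `g`, with the
two constant terms merged into their difference, solve a `(2k - 1) × (2k - 1)` system whose
determinant is a nonzero polynomial in the points: some choice of points admits only the zero
solution, by induction on the degrees of `f` and `g`, letting one point tend to infinity to drop
leading coefficients. In both cases the determinant has total degree less than `k²` and at most
`(2k - 1)!` monomials.

Such a sparse polynomial cannot vanish at the points `(γ - i) ^ e`. As `γ` has degree `k² e` over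
`𝔽_p`, it would vanish at the polynomials `(X - i) ^ e`, giving a linear relation between the `e`-th
powers of few pairwise non-proportional polynomials of small degree. A Mason–Stothers argument
excludes it: the Wronskian of the powers in the relation is divisible by almost all of each power,
which exceeds its degree. Using `X · d/dX` in place of `d/dX` keeps the Wronskian nonzero in
characteristic `p`, the degrees being less than `p`.
-/

section TopCoefficients

variable {R ι : Type*}

theorem exists_coeff_ne_zero_natDegree_le [Semiring R] [Finite ι] {v : ι → R[X]} (hv : v ≠ 0) :
    ∃ D, (∀ i, (v i).natDegree ≤ D) ∧ (fun i => (v i).coeff D) ≠ 0 := by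
  classical
  cases nonempty_fintype ι
  obtain ⟨i₀, hi₀⟩ := Function.ne_iff.mp hv
  have hne : (Finset.univ.filter fun i => v i ≠ 0).Nonempty := ⟨i₀, by simpa using hi₀⟩
  obtain ⟨j, hj, hmax⟩ := Finset.exists_max_image _ (fun i => (v i).natDegree) hne
  simp only [Finset.mem_filter, Finset.mem_univ, true_and] at hj hmax
  refine ⟨(v j).natDegree, fun i => ?_, Function.ne_iff.mpr ⟨j, by simpa using hj⟩⟩
  by_cases hi : v i = 0
  · simp [hi]
  · exact hmax i hi

theorem coeff_sum_mul_add [Semiring R] [Fintype ι] {f g : ι → R[X]} {c d : ℕ}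
    (hf : ∀ i, (f i).natDegree ≤ c) (hg : ∀ i, (g i).natDegree ≤ d) :
    (∑ i, f i * g i).coeff (c + d) = ∑ i, (f i).coeff c * (g i).coeff d := by
  rw [finsetSum_coeff]
  exact Finset.sum_congr rfl fun i _ => coeff_mul_add_eq_of_natDegree_le (hf i) (hg i)

theorem natDegree_det_le_sum [CommRing R] [Fintype ι] [DecidableEq ι] (M : Matrix ι ι R[X])
    (d : ι → ℕ) (h : ∀ i j, (M i j).natDegree ≤ d i) : M.det.natDegree ≤ ∑ i, d i := by
  rw [Matrix.det_apply]
  refine natDegree_sum_le_of_forall_le _ _ fun σ _ => (natDegree_smul_le _ _).trans ?_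
  refine (natDegree_prod_le _ _).trans ?_
  rw [← Equiv.sum_comp σ d]
  exact Finset.sum_le_sum fun i _ => h (σ i) i

end TopCoefficients

section EulerOperator

variable {R : Type*} [CommRing R]

/-- The Euler operator `X · d/dX`. It multiplies the coefficient of `X ^ m` by `m`, so that, unlike
the derivative, it does not lower degrees. -/
noncomputable def eulerOp (R : Type*) [CommRing R] : R[X] →ₗ[R] R[X] :=
  LinearMap.mulLeft R X ∘ₗ derivative

theorem coeff_eulerOp (f : R[X]) (m : ℕ) : (eulerOp R f).coeff m = m * f.coeff m := by
  change (X * derivative f).coeff m = _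
  cases m with
  | zero => simp
  | succ m => rw [coeff_X_mul, coeff_derivative, Nat.cast_succ, mul_comm]

theorem coeff_eulerOp_pow (i : ℕ) (f : R[X]) (m : ℕ) :
    ((eulerOp R ^ i) f).coeff m = (m : R) ^ i * f.coeff m := by
  induction i with
  | zero => simp
  | succ i ih => rw [pow_succ', Module.End.mul_apply, coeff_eulerOp, ih, pow_succ', mul_assoc]

theorem natDegree_eulerOp_pow_le (i : ℕ) (f : R[X]) :
    ((eulerOp R ^ i) f).natDegree ≤ f.natDegree := by
  rw [natDegree_le_iff_coeff_eq_zero]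
  intro m hm
  rw [coeff_eulerOp_pow, coeff_eq_zero_of_natDegree_lt hm, mul_zero]

theorem pow_sub_dvd_eulerOp_pow {P f : R[X]} {e : ℕ} (h : P ^ e ∣ f) (i : ℕ) :
    P ^ (e - i) ∣ (eulerOp R ^ i) f := by
  induction i with
  | zero => simpa using h
  | succ i ih =>
    rw [pow_succ', Module.End.mul_apply, ← Nat.sub_sub]
    exact (pow_sub_one_dvd_derivative_of_pow_dvd ih).mul_left X

/-- The matrix of the Wronskian of `Q` with respect to the Euler operator: its row `j` consists of
`Q j` and the iterated images of `Q j`. -/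
noncomputable def eulerMatrix {d : ℕ} (Q : Fin d → R[X]) : Matrix (Fin d) (Fin d) R[X] :=
  Matrix.of fun j i => (eulerOp R ^ (i : ℕ)) (Q j)

theorem det_eulerMatrix_update_sum {d : ℕ} (Q : Fin d → R[X]) (j : Fin d) (b : Fin d → R) :
    (eulerMatrix (Function.update Q j (∑ l, b l • Q l))).det = C (b j) * (eulerMatrix Q).det := by
  have hrow : eulerMatrix (Function.update Q j (∑ l, b l • Q l))
      = (eulerMatrix Q).updateRow j (∑ l, C (b l) • eulerMatrix Q l) := by
    ext1 l i
    obtain rfl | hl := eq_or_ne l j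
    · simp only [eulerMatrix, Matrix.of_apply, Function.update_self, map_sum, map_smul,
        Matrix.updateRow_self, Finset.sum_apply, Pi.smul_apply]
      simp only [smul_eq_C_mul, smul_eq_mul]
    · simp [eulerMatrix, hl]
  rw [hrow, Matrix.det_updateRow_sum, smul_eq_mul]

theorem natDegree_det_eulerMatrix_le {d : ℕ} (Q : Fin d → R[X]) :
    (eulerMatrix Q).det.natDegree ≤ ∑ j, (Q j).natDegree :=
  natDegree_det_le_sum _ _ fun j i => natDegree_eulerOp_pow_le i (Q j)

theorem prod_pow_dvd_det_eulerMatrix {d e : ℕ} {P Q : Fin d → R[X]} (h : ∀ j, P j ^ e ∣ Q j) :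
    ∏ j, P j ^ (e - (d - 1)) ∣ (eulerMatrix Q).det := by
  have hdvd (j i : Fin d) : P j ^ (e - (d - 1)) ∣ eulerMatrix Q j i :=
    (pow_dvd_pow _ (by omega)).trans (pow_sub_dvd_eulerOp_pow (h j) i)
  choose B hB using hdvd
  have hfactor : eulerMatrix Q = Matrix.of fun j i => P j ^ (e - (d - 1)) * Matrix.of B j i := by
    ext1 j i
    exact hB j i
  rw [hfactor, Matrix.det_mul_column]
  exact dvd_mul_right _ _

end EulerOperator

section Nonvanishing

variable {K : Type*} [Field K]

theorem exists_mem_span_coeff_eq_zero {ι : Type*} [Fintype ι] {Q : ι → K[X]}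
    (hQ : LinearIndependent K Q) {S : Finset ℕ} (hS : S.card < Fintype.card ι) :
    ∃ f ∈ Submodule.span K (Set.range Q), f ≠ 0 ∧ ∀ m ∈ S, f.coeff m = 0 := by
  let T : (ι → K) →ₗ[K] S → K :=
    (LinearMap.pi fun m : S => lcoeff K m) ∘ₗ Fintype.linearCombination K Q
  obtain ⟨b, hb, hb0⟩ := (LinearMap.ker T).exists_mem_ne_zero_of_ne_bot
    (LinearMap.ker_ne_bot_of_finrank_lt (by simpa using hS))
  refine ⟨Fintype.linearCombination K Q b, ?_, ?_, fun m hm => congrFun hb ⟨m, hm⟩⟩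
  · rw [← Fintype.range_linearCombination]
    exact LinearMap.mem_range_self _ b
  · exact fun h => hb0 (hQ.fintypeLinearCombination_injective (h.trans (map_zero _).symm))

theorem card_filter_eval_natCast_eq_zero_lt [DecidableEq K] {d p : ℕ} [CharP K p]
    {c : Fin d → K} (hc : c ≠ 0) :
    ((Finset.range p).filter fun m : ℕ => ∑ i, c i * (m : K) ^ (i : ℕ) = 0).card < d := by
  set χ : K[X] := ∑ i, C (c i) * X ^ (i : ℕ)
  have hχ (i : Fin d) : χ.coeff i = c i := by
    simp [χ, finsetSum_coeff, coeff_C_mul, coeff_X_pow, Fin.val_inj]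
  have hχ0 : χ ≠ 0 := fun h => hc (funext fun i => by rw [← hχ, h, coeff_zero, Pi.zero_apply])
  have hdeg : χ.degree < d := (degree_sum_fin_lt c)
  rw [← natDegree_lt_iff_degree_lt hχ0] at hdeg
  refine lt_of_le_of_lt ?_ hdeg
  refine le_trans ?_ ((Multiset.toFinset_card_le _).trans (card_roots' χ))
  refine Finset.card_le_card_of_injOn Nat.cast (fun m hm => ?_) fun m hm m' hm' h => ?_
  · have := (Finset.mem_filter.mp hm).2
    simpa [χ, hχ0, eval_finsetSum] using this
  · exact CharP.natCast_injOn_Iio K p (by simpa using (Finset.mem_filter.mp hm).1)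
      (by simpa using (Finset.mem_filter.mp hm').1) h

theorem det_eulerMatrix_ne_zero (p : ℕ) [CharP K p] {d : ℕ} {Q : Fin d → K[X]}
    (hQ : LinearIndependent K Q) (hdeg : ∀ j, (Q j).natDegree < p) : (eulerMatrix Q).det ≠ 0 := by
  classical
  intro hdet
  obtain ⟨v, hv0, hv⟩ := Matrix.exists_mulVec_eq_zero_iff.mpr hdet
  have hker (f : K[X]) (hf : f ∈ Submodule.span K (Set.range Q)) :
      ∑ i : Fin d, v i * (eulerOp K ^ (i : ℕ)) f = 0 := by
    induction hf using Submodule.span_induction with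
    | mem f hf =>
      obtain ⟨j, rfl⟩ := hf
      simpa [Matrix.mulVec, dotProduct, eulerMatrix, mul_comm] using congrFun hv j
    | zero => simp
    | add f g _ _ hf hg => simp [mul_add, Finset.sum_add_distrib, hf, hg]
    | smul c f _ hf => simp only [map_smul, mul_smul_comm, ← Finset.smul_sum, hf, smul_zero]
  obtain ⟨D, hD, hvD⟩ := exists_coeff_ne_zero_natDegree_le hv0
  obtain ⟨f, hf, hf0, hfS⟩ := exists_mem_span_coeff_eq_zero hQ
    ((card_filter_eval_natCast_eq_zero_lt (p := p) hvD).trans_eq (Fintype.card_fin d).symm)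
  have hfp : f.natDegree < p := by
    have hle : Submodule.span K (Set.range Q) ≤ degreeLT K p :=
      Submodule.span_le.mpr <| Set.range_subset_iff.mpr fun j =>
        mem_degreeLT.mpr <| degree_le_natDegree.trans_lt (by exact_mod_cast hdeg j)
    exact (natDegree_lt_iff_degree_lt hf0).mpr (mem_degreeLT.mp (hle hf))
  -- The top coefficient of `∑ v i * θ ^ i f` is the leading coefficient of `f` times `χ (deg f)`,
  -- where `χ` is the polynomial whose coefficients are the top coefficients of the `v i`.
  have htop := coeff_sum_mul_add hD fun i : Fin d => natDegree_eulerOp_pow_le i f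
  simp only [hker f hf, coeff_zero, coeff_eulerOp_pow, ← mul_assoc, ← Finset.sum_mul] at htop
  rcases mul_eq_zero.mp htop.symm with hχ | hlead
  · refine leadingCoeff_ne_zero.mpr hf0 (hfS _ ?_)
    exact Finset.mem_filter.mpr ⟨Finset.mem_range.mpr hfp, hχ⟩
  · exact leadingCoeff_ne_zero.mpr hf0 hlead

end Nonvanishing

section PowerIndependence

theorem exists_eq_mul_span_range_eq_top {R ι : Type*} [CommRing R] [IsDomain R]
    [IsPrincipalIdealRing R] {P : ι → R} (hP : P ≠ 0) :
    ∃ (g : R) (A : ι → R), (∀ i, P i = g * A i) ∧ Ideal.span (Set.range A) = ⊤ := by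
  obtain ⟨g, hg⟩ := (IsPrincipalIdealRing.principal (Ideal.span (Set.range P))).principal
  rw [← Ideal.span] at hg
  have hdvd (i : ι) : g ∣ P i := by
    rw [← Ideal.mem_span_singleton, ← hg]
    exact Ideal.subset_span ⟨i, rfl⟩
  choose A hA using hdvd
  have hg0 : g ≠ 0 := fun h => hP (funext fun i => by simp [hA, h])
  refine ⟨g, A, hA, (Ideal.span_singleton_mul_right_inj hg0).mp ?_⟩
  rw [Ideal.mul_top, Ideal.span_mul_span', Set.singleton_mul, ← Set.range_comp, ← hg]
  exact congrArg (fun f : ι → R => Ideal.span (Set.range f)) (funext fun i => (hA i).symm)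

variable {K : Type*} [Field K] {d e : ℕ}

theorem prod_pow_dvd_det_eulerMatrix_of_pow_eq_sum {P : Fin (d + 1) → K[X]} {b : Fin d → K}
    (hb : ∀ j, b j ≠ 0) (hsum : P 0 ^ e = ∑ j, b j • P (Fin.succ j) ^ e)
    (htop : Ideal.span (Set.range P) = ⊤) :
    ∏ i, P i ^ (e - (d - 1)) ∣ (eulerMatrix fun j : Fin d => P j.succ ^ e).det := by
  set Q : Fin d → K[X] := fun j => P j.succ ^ e
  set N := e - (d - 1)
  have hdvd (i : Fin (d + 1)) : ∏ l, P l ^ N ∣ P i ^ N * (eulerMatrix Q).det := by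
    induction i using Fin.cases with
    | zero =>
      rw [Fin.prod_univ_succ]
      exact mul_dvd_mul_left _ (prod_pow_dvd_det_eulerMatrix fun j => dvd_rfl)
    | succ j =>
      -- By the relation, row `j` may be replaced by the row of `P 0 ^ e` at the cost of a unit.
      have hupdate := prod_pow_dvd_det_eulerMatrix (e := e)
        (P := Function.update (fun l => P (Fin.succ l)) j (P 0))
        (Q := Function.update Q j (P 0 ^ e)) fun l => by
          obtain rfl | hl := eq_or_ne l j
          · simp
          · simp [hl, Q]
      rw [hsum, det_eulerMatrix_update_sum,
        (isUnit_C.mpr (hb j).isUnit).dvd_mul_left] at hupdate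
      have hswap : ∏ l, P l ^ N =
          P j.succ ^ N * ∏ l, Function.update (fun l => P (Fin.succ l)) j (P 0) l ^ N := by
        rw [Fin.prod_univ_succ, ← Finset.mul_prod_erase _ _ (Finset.mem_univ j),
          ← Finset.mul_prod_erase _ _ (Finset.mem_univ j), Function.update_self, mul_left_comm]
        congr 2
        exact Finset.prod_congr rfl fun l hl => by
          rw [Function.update_of_ne (Finset.ne_of_mem_erase hl)]
      rw [hswap]
      exact mul_dvd_mul_left _ hupdate
  have hspan := Ideal.span_pow_eq_top _ htop N
  rw [← Set.range_comp, Ideal.eq_top_iff_one, Ideal.mem_span_range_iff_exists_fun] at hspan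
  obtain ⟨c, hc⟩ := hspan
  rw [← one_mul (eulerMatrix Q).det, ← hc, Finset.sum_mul]
  refine Finset.dvd_sum fun i _ => ?_
  rw [mul_assoc]
  exact (hdvd i).mul_left _

theorem mul_natDegree_le_of_pow_eq_sum (p : ℕ) [CharP K p] {P : Fin (d + 1) → K[X]}
    {b : Fin d → K} (hb : ∀ j, b j ≠ 0) (hsum : P 0 ^ e = ∑ j, b j • P (Fin.succ j) ^ e)
    (hind : LinearIndependent K fun j : Fin d => P j.succ ^ e) (hP : ∀ i, P i ≠ 0)
    (htop : Ideal.span (Set.range P) = ⊤) (hp : ∀ i, e * (P i).natDegree < p) :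
    e * (P 0).natDegree ≤ (d - 1) * ∑ i, (P i).natDegree := by
  have hdet := det_eulerMatrix_ne_zero p hind fun j => (natDegree_pow _ _).trans_lt (hp _)
  have hle : (e - (d - 1)) * ∑ i, (P i).natDegree ≤ e * ∑ j : Fin d, (P j.succ).natDegree :=
    calc (e - (d - 1)) * ∑ i, (P i).natDegree
        = (∏ i, P i ^ (e - (d - 1))).natDegree := by
          rw [natDegree_prod _ _ fun i _ => pow_ne_zero _ (hP i), Finset.mul_sum]
          simp only [natDegree_pow]
      _ ≤ (eulerMatrix fun j : Fin d => P j.succ ^ e).det.natDegree :=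
          natDegree_le_of_dvd (prod_pow_dvd_det_eulerMatrix_of_pow_eq_sum hb hsum htop) hdet
      _ ≤ ∑ j : Fin d, (P j.succ ^ e).natDegree := natDegree_det_eulerMatrix_le _
      _ = e * ∑ j : Fin d, (P j.succ).natDegree := by
          rw [Finset.mul_sum]
          simp only [natDegree_pow]
  have he : e * ∑ i, (P i).natDegree ≤ (e - (d - 1) + (d - 1)) * ∑ i, (P i).natDegree :=
    Nat.mul_le_mul_right _ (by omega)
  rw [add_mul] at he
  rw [Fin.sum_univ_succ, mul_add] at he
  rw [Fin.sum_univ_succ] at hle ⊢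
  omega

theorem natDegree_eq_zero_of_pow_eq_sum (p : ℕ) [CharP K p] {P : Fin (d + 1) → K[X]}
    {b : Fin d → K} (hb : ∀ j, b j ≠ 0) (hsum : P 0 ^ e = ∑ j, b j • P (Fin.succ j) ^ e)
    (hind : LinearIndependent K fun j : Fin d => P j.succ ^ e) (hP : ∀ i, P i ≠ 0)
    (htop : Ideal.span (Set.range P) = ⊤) (hdeg : ∀ i, (P i).natDegree ≤ (P 0).natDegree)
    (hp : e * (P 0).natDegree < p) (hde : (d + 1) ^ 2 ≤ e) : (P 0).natDegree = 0 := by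
  by_contra h0
  have hmason := mul_natDegree_le_of_pow_eq_sum p hb hsum hind hP htop fun i =>
    (Nat.mul_le_mul_left e (hdeg i)).trans_lt hp
  have hsumdeg : ∑ i, (P i).natDegree ≤ (d + 1) * (P 0).natDegree := by
    simpa using Finset.sum_le_card_nsmul Finset.univ _ _ fun i _ => hdeg i
  have hmul : (d + 1) ^ 2 * (P 0).natDegree ≤ (d - 1) * (d + 1) * (P 0).natDegree :=
    calc (d + 1) ^ 2 * (P 0).natDegree
        ≤ e * (P 0).natDegree := Nat.mul_le_mul_right _ hde
      _ ≤ (d - 1) * ∑ i, (P i).natDegree := hmason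
      _ ≤ (d - 1) * (d + 1) * (P 0).natDegree :=
          (Nat.mul_le_mul_left _ hsumdeg).trans_eq (mul_assoc _ _ _).symm
  have hle := Nat.le_of_mul_le_mul_right hmul (Nat.pos_of_ne_zero h0)
  have : (d - 1) * (d + 1) ≤ d * (d + 1) := Nat.mul_le_mul_right _ (Nat.sub_le d 1)
  nlinarith

theorem pow_ne_sum_smul_pow (p : ℕ) [CharP K p] {P : Fin (d + 1) → K[X]}
    {b : Fin d → K} (hb : ∀ j, b j ≠ 0)
    (hind : LinearIndependent K fun j : Fin d => P j.succ ^ e) (hP : ∀ i, P i ≠ 0)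
    (hdeg : ∀ i, (P i).natDegree ≤ (P 0).natDegree) (hp : e * (P 0).natDegree < p)
    (hprop : ∀ (j : Fin d) (c : K), P 0 ≠ C c * P j.succ) (hde : (d + 1) ^ 2 ≤ e) :
    P 0 ^ e ≠ ∑ j, b j • P (Fin.succ j) ^ e := by
  intro hsum
  obtain ⟨g, A, hA, htop⟩ := exists_eq_mul_span_range_eq_top fun h : P = 0 => hP 0 (by simp [h])
  have hg0 : g ≠ 0 := fun h => hP 0 (by rw [hA, h, zero_mul])
  have hA0 (i) : A i ≠ 0 := fun h => hP i (by rw [hA, h, mul_zero])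
  have hdegA (i) : (A i).natDegree ≤ (A 0).natDegree := by
    have := hdeg i
    rw [hA, hA 0, natDegree_mul hg0 (hA0 i), natDegree_mul hg0 (hA0 0)] at this
    omega
  have hindA : LinearIndependent K fun j : Fin d => A j.succ ^ e := by
    refine LinearIndependent.of_comp (LinearMap.mulLeft K (g ^ e)) ?_
    simpa only [hA, mul_pow, Function.comp_def, LinearMap.mulLeft_apply] using hind
  have hsumA : A 0 ^ e = ∑ j, b j • A (Fin.succ j) ^ e := by
    refine mul_left_cancel₀ (pow_ne_zero e hg0) ?_
    simpa only [hA, mul_pow, Finset.mul_sum, mul_smul_comm] using hsum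
  have hpA : e * (A 0).natDegree < p := by
    refine (Nat.mul_le_mul_left e ?_).trans_lt hp
    rw [hA 0, natDegree_mul hg0 (hA0 0)]
    omega
  have hA0deg := natDegree_eq_zero_of_pow_eq_sum p hb hsumA hindA hA0 htop hdegA hpA hde
  cases d with
  | zero => exact pow_ne_zero e (hP 0) (by simpa using hsum)
  | succ d =>
    obtain ⟨a₀, ha₀⟩ := natDegree_eq_zero.mp hA0deg
    obtain ⟨a₁, ha₁⟩ := natDegree_eq_zero.mp (Nat.le_zero.mp ((hdegA 1).trans_eq hA0deg))
    have ha₁0 : a₁ ≠ 0 := fun h => hA0 1 (by rw [← ha₁, h, C_0])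
    refine hprop 0 (a₀ / a₁) ?_
    rw [Fin.succ_zero_eq_one, hA 0, hA 1, ← ha₀, ← ha₁, mul_left_comm, ← C_mul,
      div_mul_cancel₀ _ ha₁0]

theorem linearIndepOn_pow (p : ℕ) [CharP K p] {ι : Type*} (s : Finset ι)
    {P : ι → K[X]} (h0 : ∀ i ∈ s, P i ≠ 0)
    (hprop : ∀ i ∈ s, ∀ j ∈ s, i ≠ j → ∀ c : K, P i ≠ C c * P j)
    (hp : ∀ i ∈ s, e * (P i).natDegree < p) (he : s.card ^ 2 ≤ e) :
    LinearIndepOn K (fun i => P i ^ e) (s : Set ι) := by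
  classical
  induction s using Finset.induction_on_max_value (fun i => (P i).natDegree) with
  | empty => simp
  | insert a s ha hmax ih =>
    simp only [Finset.forall_mem_insert] at h0 hprop hp
    have hind := ih h0.2 (fun i hi j hj => (hprop.2 i hi).2 j hj) hp.2
      ((Nat.pow_le_pow_left (Finset.card_le_card (Finset.subset_insert a s)) 2).trans he)
    rw [Finset.coe_insert]
    refine hind.insert fun hmem => ?_
    obtain ⟨b, hb⟩ := (Submodule.mem_span_image_finset_iff_exists_fun K).mp hmem
    set t : Finset s := Finset.univ.filter fun i => b i ≠ 0 with ht
    let ε := t.equivFin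
    let σ : Fin (t.card + 1) → ι := Fin.cons a fun j => (ε.symm j).1
    have hσ (j : Fin t.card) : σ j.succ ∈ s := (ε.symm j).1.2
    have hb0 (j : Fin t.card) : b (ε.symm j).1 ≠ 0 := (Finset.mem_filter.mp (ε.symm j).2).2
    have hindt : LinearIndependent K fun j : Fin t.card => P (σ j.succ) ^ e :=
      hind.comp (fun j => (ε.symm j).1) (Subtype.val_injective.comp ε.symm.injective)
    have hcard : (t.card + 1) ^ 2 ≤ e := by
      rw [Finset.card_insert_of_notMem ha] at he
      have : t.card ≤ s.card := (Finset.card_le_univ t).trans_eq (Fintype.card_coe s)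
      exact (Nat.pow_le_pow_left (by omega) 2).trans he
    refine pow_ne_sum_smul_pow p hb0 hindt (P := P ∘ σ) ?_ ?_ hp.1 ?_ hcard ?_
    · exact Fin.cases h0.1 fun j => h0.2 _ (hσ j)
    · exact Fin.cases le_rfl fun j => hmax _ (hσ j)
    · exact fun j => hprop.1.2 _ (hσ j) (ne_of_mem_of_not_mem (hσ j) ha).symm
    · change P a ^ e = ∑ j, b (ε.symm j).1 • P (ε.symm j).1 ^ e
      rw [← hb, Equiv.sum_comp ε.symm fun i : t => b i.1 • P i.1 ^ e,
        Finset.sum_coe_sort t fun i => b i • P i ^ e, ht, Finset.sum_filter]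
      exact Finset.sum_congr rfl fun i _ => by split_ifs with h <;> simp_all

end PowerIndependence

section SparseIndependence

/-- No nonzero polynomial over `R` of total degree less than `d` with at most `s` monomials
vanishes at the points `x`. -/
def SparselyIndependent {V A : Type*} (R : Type*) [CommRing R] [CommRing A] [Algebra R A]
    (x : V → A) (d s : ℕ) : Prop :=
  ∀ D : MvPolynomial V R, D ≠ 0 → D.totalDegree < d → D.support.card ≤ s →
    MvPolynomial.aeval x D ≠ 0

variable {V K : Type*} [Field K] {a : V → K}

theorem count_roots_prod_X_sub_C_pow [Fintype V] [DecidableEq K] (ha : Function.Injective a)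
    (m : V → ℕ) (v : V) : (∏ w, (X - C (a w)) ^ m w).roots.count (a v) = m v := by
  classical
  rw [roots_prod _ _ (Finset.prod_ne_zero_iff.mpr fun w _ => pow_ne_zero _ (X_sub_C_ne_zero _))]
  simp [Multiset.count_bind, Multiset.count_singleton, ha.eq_iff]

theorem eq_of_prod_X_sub_C_pow_eq_C_mul [Fintype V] (ha : Function.Injective a) {m m' : V → ℕ}
    {c : K} (h : ∏ v, (X - C (a v)) ^ m v = C c * ∏ v, (X - C (a v)) ^ m' v) : m = m' := by
  classical
  have hc : c ≠ 0 := by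
    rintro rfl
    rw [C_0, zero_mul] at h
    exact Finset.prod_ne_zero_iff.mpr (fun v _ => pow_ne_zero _ (X_sub_C_ne_zero _)) h
  funext v
  rw [← count_roots_prod_X_sub_C_pow ha m, h, roots_C_mul _ hc, count_roots_prod_X_sub_C_pow ha]

theorem sparselyIndependent_X_sub_C_pow [Finite V] (p : ℕ) [CharP K p]
    (ha : Function.Injective a) {d e s : ℕ} (hp : e * d ≤ p) (hs : s ^ 2 ≤ e) :
    SparselyIndependent K (fun v => (X - C (a v)) ^ e) d s := by
  cases nonempty_fintype V
  intro D hD hdeg hcard h0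
  have he : 0 < e := by
    have := Finset.card_pos.mpr (MvPolynomial.support_nonempty.mpr hD)
    nlinarith
  let P : (V →₀ ℕ) → K[X] := fun m => ∏ v, (X - C (a v)) ^ m v
  have hPdeg (m) (hm : m ∈ D.support) : (P m).natDegree ≤ D.totalDegree := by
    rw [natDegree_prod_of_monic _ _ fun v _ => (monic_X_sub_C _).pow _]
    simp only [natDegree_pow, natDegree_X_sub_C, mul_one]
    rw [← Finsupp.sum_fintype m (fun _ r => r) fun _ => rfl]
    exact MvPolynomial.le_totalDegree hm
  have hind : LinearIndepOn K (fun m => P m ^ e) (D.support : Set (V →₀ ℕ)) :=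
    linearIndepOn_pow p D.support
      (fun m _ => Finset.prod_ne_zero_iff.mpr fun v _ => pow_ne_zero _ (X_sub_C_ne_zero _))
      (fun m _ m' _ hne c h => hne (DFunLike.coe_injective (eq_of_prod_X_sub_C_pow_eq_C_mul ha h)))
      (fun m hm => (Nat.mul_lt_mul_of_pos_left ((hPdeg m hm).trans_lt hdeg) he).trans_le hp)
      ((Nat.pow_le_pow_left hcard 2).trans hs)
  have hexpand : MvPolynomial.aeval (fun v => (X - C (a v)) ^ e) D
      = ∑ m ∈ D.support, D.coeff m • P m ^ e := by
    simp only [MvPolynomial.aeval_def, MvPolynomial.eval₂_eq', P, Algebra.smul_def,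
      ← Finset.prod_pow, ← pow_mul, mul_comm]
  obtain ⟨m, hm⟩ := MvPolynomial.support_nonempty.mpr hD
  exact MvPolynomial.mem_support_iff.mp hm
    (linearIndepOn_finset_iff.mp hind _ (hexpand.symm.trans h0) m hm)

end SparseIndependence

section PowPoints

variable {k e n p : ℕ} [Fact p.Prime] {F : Type*} [Field F] [Algebra (ZMod p) F] {γ : F}

theorem IsPowConstruction.eq_zero_of_aeval_eq_zero (h : IsPowConstruction k e n p F γ)
    (hpos : 0 < k ^ 2 * e) {G : (ZMod p)[X]} (hdeg : G.degree < (k ^ 2 * e : ℕ))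
    (h0 : aeval γ G = 0) : G = 0 := by
  by_contra hG
  have : FiniteDimensional (ZMod p) F := Module.finite_of_finrank_pos (h.finrank_eq ▸ hpos)
  have hmin : (minpoly (ZMod p) γ).natDegree = k ^ 2 * e := by
    rw [← IntermediateField.adjoin.finrank (Algebra.IsIntegral.isIntegral γ), h.adjoin_eq,
      IntermediateField.finrank_top', h.finrank_eq]
  refine (minpoly.degree_le_of_ne_zero (ZMod p) γ hG h0).not_gt ?_
  rwa [degree_eq_natDegree (minpoly.ne_zero (Algebra.IsIntegral.isIntegral γ)), hmin]

theorem injective_natCast_succ (hn : n ≤ p) :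
    Function.Injective fun i : Fin n => (((i : ℕ) + 1 : ℕ) : ZMod p) := by
  intro i j hij
  simp only [Nat.cast_add, Nat.cast_one, add_left_inj] at hij
  exact Fin.ext (CharP.natCast_injOn_Iio (ZMod p) p (i.2.trans_le hn) (j.2.trans_le hn) hij)

theorem powPoints_eq_aeval (γ : F) (e n : ℕ) : powPoints γ e n =
    fun i : Fin n => aeval γ ((X - C (((i : ℕ) + 1 : ℕ) : ZMod p)) ^ e) := by
  funext i
  simp [powPoints]

theorem IsPowConstruction.sparselyIndependent_powPoints (h : IsPowConstruction k e n p F γ)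
    {s : ℕ} (hs : s ^ 2 ≤ e) : SparselyIndependent (ZMod p) (powPoints γ e n) (k ^ 2) s := by
  intro D hD hdeg hcard h0
  rw [powPoints_eq_aeval (p := p), ← MvPolynomial.comp_aeval_apply] at h0
  have he : 0 < e := by
    have := Finset.card_pos.mpr (MvPolynomial.support_nonempty.mpr hD)
    nlinarith
  refine sparselyIndependent_X_sub_C_pow p (injective_natCast_succ h.le_prime)
    (mul_comm e _ ▸ h.lt_prime.le) hs D hD hdeg hcard (h.eq_zero_of_aeval_eq_zero ?_ ?_ h0)
  · exact Nat.mul_pos (Nat.zero_lt_of_lt hdeg) he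
  · have hle := MvPolynomial.aeval_natDegree_le (n := e) D le_rfl
      (fun i : Fin n => (X - C (((i : ℕ) + 1 : ℕ) : ZMod p)) ^ e) fun i => by
        rw [natDegree_pow, natDegree_X_sub_C, mul_one]
    exact degree_le_natDegree.trans_lt
      (by exact_mod_cast hle.trans_lt (Nat.mul_lt_mul_of_pos_right hdeg he))

theorem IsPowConstruction.powPoints_ne_zero (h : IsPowConstruction k e n p F γ)
    (he : 1 < k ^ 2 * e) (i : Fin n) : powPoints γ e n i ≠ 0 := by
  refine pow_ne_zero _ fun h0 => X_sub_C_ne_zero (((i : ℕ) + 1 : ℕ) : ZMod p) ?_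
  refine h.eq_zero_of_aeval_eq_zero (by omega) ?_ ?_
  · rw [degree_X_sub_C]
    exact_mod_cast he
  · simpa using h0

theorem IsPowConstruction.powPoints_injective (h : IsPowConstruction k e n p F γ)
    (hk : 1 ≤ k) (he : 0 < e) : Function.Injective (powPoints γ e n) := by
  intro i j hij
  set P : Fin n → (ZMod p)[X] := fun i => (X - C (((i : ℕ) + 1 : ℕ) : ZMod p)) ^ e
  have hmonic (i) : (P i).Monic := (monic_X_sub_C _).pow _
  have hdeg (i) : (P i).degree = e := by rw [degree_pow, degree_X_sub_C, nsmul_one]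
  have hlt : (P i - P j).degree < e := by
    rw [← hdeg i]
    exact degree_sub_lt_left (by rw [hdeg, hdeg]) (hmonic i).ne_zero (by rw [hmonic i, hmonic j])
  have hle : e ≤ k ^ 2 * e := Nat.le_mul_of_pos_left _ (pow_pos hk 2)
  have hP : P i - P j = 0 := by
    refine h.eq_zero_of_aeval_eq_zero (he.trans_le hle)
      (hlt.trans_le (by exact_mod_cast hle)) ?_
    rw [powPoints_eq_aeval (p := p)] at hij
    rw [map_sub]
    exact sub_eq_zero.mpr hij
  have hroot := congrArg (eval (((i : ℕ) + 1 : ℕ) : ZMod p)) hP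
  simp only [P, eval_sub, eval_pow, eval_X, eval_C, sub_self, zero_pow he.ne', zero_sub,
    eval_zero, neg_eq_zero] at hroot
  exact injective_natCast_succ h.le_prime (sub_eq_zero.mp (pow_eq_zero_iff he.ne' |>.mp hroot))

end PowPoints

section SparseDeterminants

variable {σ R ι : Type*} [CommRing R]

theorem card_support_prod_le (s : Finset ι) (f : ι → MvPolynomial σ R) :
    (∏ i ∈ s, f i).support.card ≤ ∏ i ∈ s, (f i).support.card := by
  classical
  induction s using Finset.induction_on with
  | empty => exact (Finset.card_le_card MvPolynomial.support_monomial_subset).trans (by simp)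
  | insert a s ha ih =>
    rw [Finset.prod_insert ha, Finset.prod_insert ha]
    exact (Finset.card_le_card (MvPolynomial.support_mul _ _)).trans <|
      Finset.card_add_le.trans (Nat.mul_le_mul_left _ ih)

variable [Fintype ι] [DecidableEq ι] (M : Matrix ι ι (MvPolynomial σ R))

theorem card_support_det_le (S : ι → ℕ) (hS : ∀ i j, (M i j).support.card ≤ S i) :
    M.det.support.card ≤ (Fintype.card ι)! * ∏ i, S i := by
  classical
  rw [Matrix.det_apply, ← Fintype.card_perm, ← smul_eq_mul, ← Finset.card_univ]
  refine (Finset.card_le_card MvPolynomial.support_sum).trans (Finset.card_biUnion_le.trans ?_)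
  refine Finset.sum_le_card_nsmul _ _ _ fun π _ => ?_
  calc (Equiv.Perm.sign π • ∏ i, M (π i) i).support.card
      ≤ (∏ i, M (π i) i).support.card := Finset.card_le_card Finsupp.support_smul
    _ ≤ ∏ i, (M (π i) i).support.card := card_support_prod_le _ _
    _ ≤ ∏ i, S (π i) := Finset.prod_le_prod' fun i _ => hS _ _
    _ = ∏ i, S i := Equiv.prod_comp π S

theorem totalDegree_det_le (w : ι → ℕ) (hw : ∀ i j, (M i j).totalDegree ≤ w j) :
    M.det.totalDegree ≤ ∑ j, w j := by
  rw [Matrix.det_apply]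
  refine MvPolynomial.totalDegree_finsetSum_le fun π _ => ?_
  refine (MvPolynomial.totalDegree_smul_le _ _).trans ?_
  exact (MvPolynomial.totalDegree_finsetProd _ _).trans (Finset.sum_le_sum fun i _ => hw _ i)

end SparseDeterminants

section MatchMatrix

variable {V ρ A B : Type*} [CommRing A] [CommRing B] {a b : ℕ}

/-- The row expressing `f y - g z` through the coefficients of `f` (degree at most `a`) and the
non-constant coefficients of `g` (degree at most `b`). The constant coefficient of `g` is left out
because only the difference of the constant coefficients matters. -/
def matchRow (a b : ℕ) (y z : A) : Fin (a + 1) ⊕ Fin b → A :=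
  Sum.elim (fun r => y ^ (r : ℕ)) fun r => -z ^ ((r : ℕ) + 1)

/-- The matrix of the linear system `f (x (I j)) = g (x (J j))` in the coefficients of `f` and
`g`. -/
def matchMatrix (a b : ℕ) (I J : ρ → V) (x : V → A) : Matrix ρ (Fin (a + 1) ⊕ Fin b) A :=
  Matrix.of fun j => matchRow a b (x (I j)) (x (J j))

theorem map_matchMatrix (f : A →+* B) (I J : ρ → V) (x : V → A) :
    (matchMatrix a b I J x).map f = matchMatrix a b I J fun v => f (x v) := by
  ext j (r | r) <;> simp [matchMatrix, matchRow]

theorem aeval_det_matchMatrix_X [Algebra A B] (I J : Fin (a + 1) ⊕ Fin b → V) (x : V → B) :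
    MvPolynomial.aeval x (matchMatrix a b I J (MvPolynomial.X (R := A))).det
      = (matchMatrix a b I J x).det := by
  rw [AlgHom.map_det, AlgHom.mapMatrix_apply]
  congr 1
  ext j (r | r) <;> simp [matchMatrix, matchRow]

/-- The pair of polynomials with a given vector of coefficients, in the order of `matchRow`. -/
noncomputable def matchPair (w : Fin (a + 1) ⊕ Fin b → A) : A[X] × A[X] :=
  (∑ r, C (w (.inl r)) * X ^ (r : ℕ), ∑ r, C (w (.inr r)) * X ^ ((r : ℕ) + 1))

theorem natDegree_matchPair_fst_le (w : Fin (a + 1) ⊕ Fin b → A) :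
    (matchPair w).1.natDegree ≤ a := by
  change (∑ r : Fin (a + 1), C (w (.inl r)) * X ^ (r : ℕ)).natDegree ≤ a
  exact natDegree_sum_le_of_forall_le _ _ fun r _ =>
    (natDegree_C_mul_X_pow_le _ _).trans (Nat.le_of_lt_succ r.2)

theorem natDegree_matchPair_snd_le (w : Fin (a + 1) ⊕ Fin b → A) :
    (matchPair w).2.natDegree ≤ b := by
  change (∑ r : Fin b, C (w (.inr r)) * X ^ ((r : ℕ) + 1)).natDegree ≤ b
  exact natDegree_sum_le_of_forall_le _ _ fun r _ => (natDegree_C_mul_X_pow_le _ _).trans r.2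

theorem coeff_matchPair_fst (w : Fin (a + 1) ⊕ Fin b → A) (r : Fin (a + 1)) :
    (matchPair w).1.coeff r = w (.inl r) := by
  simp [matchPair, finsetSum_coeff, coeff_C_mul, coeff_X_pow, Fin.val_inj]

theorem coeff_zero_matchPair_snd (w : Fin (a + 1) ⊕ Fin b → A) : (matchPair w).2.coeff 0 = 0 := by
  simp [matchPair, finsetSum_coeff]

theorem coeff_succ_matchPair_snd (w : Fin (a + 1) ⊕ Fin b → A) (r : Fin b) :
    (matchPair w).2.coeff (r + 1) = w (.inr r) := by
  simp [matchPair, finsetSum_coeff, coeff_C_mul, coeff_X_pow, Fin.val_inj]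

theorem eq_zero_of_matchPair_eq_C {w : Fin (a + 1) ⊕ Fin b → A} {c : A}
    (h₁ : (matchPair w).1 = C c) (h₂ : (matchPair w).2 = C c) : w = 0 := by
  obtain rfl : c = 0 := by simpa [h₂] using coeff_zero_matchPair_snd w
  funext i
  rcases i with r | r
  · simpa [h₁] using (coeff_matchPair_fst w r).symm
  · simpa [h₂] using (coeff_succ_matchPair_snd w r).symm

theorem exists_matchPair_eq {f g : A[X]} (hf : f.natDegree ≤ a) (hg : g.natDegree ≤ b) :
    ∃ w : Fin (a + 1) ⊕ Fin b → A, matchPair w = (f - C (g.coeff 0), g - C (g.coeff 0)) := by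
  refine ⟨Sum.elim (fun r => (f - C (g.coeff 0)).coeff r) fun r => g.coeff (r + 1),
    Prod.ext ?_ ?_⟩
  · conv_rhs => rw [as_sum_range' (f - C (g.coeff 0)) (a + 1) (by rw [natDegree_sub_C]; omega),
      Finset.sum_range]
    simp only [matchPair, Sum.elim_inl, C_mul_X_pow_eq_monomial]
  · conv_rhs => rw [as_sum_range' g (b + 1) (by omega), Finset.sum_range, Fin.sum_univ_succ]
    simp [matchPair, C_mul_X_pow_eq_monomial]

theorem sum_smul_matchRow [Algebra A B] (y z : B) (w : Fin (a + 1) ⊕ Fin b → A) :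
    ∑ c, w c • matchRow a b y z c = aeval y (matchPair w).1 - aeval z (matchPair w).2 := by
  simp [matchRow, matchPair, Fintype.sum_sum_type, Algebra.smul_def, sub_eq_add_neg]

theorem card_support_matchRow_X_le (I J : ρ → V) (j : ρ) (c : Fin (a + 1) ⊕ Fin b) :
    (matchMatrix a b I J (MvPolynomial.X (R := A)) j c).support.card ≤ 1 := by
  rcases c with r | r <;>
    simp only [matchMatrix, matchRow, Matrix.of_apply, Sum.elim_inl, Sum.elim_inr,
      MvPolynomial.X_pow_eq_monomial, MvPolynomial.support_neg] <;>
    exact (Finset.card_le_card MvPolynomial.support_monomial_subset).trans (by simp)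

theorem totalDegree_det_matchMatrix_X_le (I J : Fin (a + 1) ⊕ Fin b → V) :
    2 * (matchMatrix a b I J (MvPolynomial.X (R := A))).det.totalDegree
      ≤ a * (a + 1) + b * (b + 1) := by
  have hgauss (m : ℕ) : (∑ r : Fin (m + 1), (r : ℕ)) * 2 = m * (m + 1) := by
    rw [Fin.sum_univ_eq_sum_range fun r => r, Finset.sum_range_id_mul_two, mul_comm]
    rfl
  have hdet := totalDegree_det_le (matchMatrix a b I J (MvPolynomial.X (R := A)))
    (Sum.elim (fun r => (r : ℕ)) fun r => (r : ℕ) + 1) fun j c => by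
      rcases c with r | r <;>
        simp only [matchMatrix, matchRow, Matrix.of_apply, Sum.elim_inl, Sum.elim_inr,
          MvPolynomial.X_pow_eq_monomial, MvPolynomial.totalDegree_neg] <;>
        exact (MvPolynomial.totalDegree_monomial_le _ _).trans (by simp [-Finsupp.single_add])
  have hb := hgauss b
  rw [Fin.sum_univ_succ] at hb
  simp only [Fintype.sum_sum_type, Sum.elim_inl, Sum.elim_inr] at hdet
  simp only [Fin.val_zero, zero_add, Fin.val_succ] at hb
  have ha := hgauss a
  omega

end MatchMatrix

section OnlyConstMatch

variable {V ρ K : Type*} [Field K] {a b : ℕ} {E : Finset ρ} {I J : ρ → V}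

/-- Only equal constants among the pairs `f, g` of polynomials of degree at most `a` and `b`
satisfy `f (x (I j)) = g (x (J j))` for all `j ∈ E`. -/
def OnlyConstMatch (E : Finset ρ) (I J : ρ → V) (a b : ℕ) (x : V → K) : Prop :=
  ∀ f g : K[X], f.natDegree ≤ a → g.natDegree ≤ b →
    (∀ j ∈ E, f.eval (x (I j)) = g.eval (x (J j))) → ∃ c, f = C c ∧ g = C c

theorem onlyConstMatch_iff_det_ne_zero (ε : Fin (a + 1) ⊕ Fin b ≃ E) {x : V → K} :
    OnlyConstMatch E I J a b x ↔
      (matchMatrix a b (fun i => I (ε i)) (fun i => J (ε i)) x).det ≠ 0 := by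
  have hrow (w : Fin (a + 1) ⊕ Fin b → K) (i) :
      (matchMatrix a b (fun i => I (ε i)) (fun i => J (ε i)) x).mulVec w i
        = (matchPair w).1.eval (x (I (ε i))) - (matchPair w).2.eval (x (J (ε i))) := by
    rw [← coe_aeval_eq_eval, ← coe_aeval_eq_eval, ← sum_smul_matchRow]
    simp [Matrix.mulVec, dotProduct, matchMatrix, mul_comm]
  rw [Ne, ← Matrix.exists_mulVec_eq_zero_iff]
  constructor
  · rintro H ⟨w, hw0, hw⟩
    obtain ⟨c, h₁, h₂⟩ := H _ _ (natDegree_matchPair_fst_le w) (natDegree_matchPair_snd_le w)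
      fun j hj => by simpa [hrow, sub_eq_zero] using congrFun hw (ε.symm ⟨j, hj⟩)
    exact hw0 (eq_zero_of_matchPair_eq_C h₁ h₂)
  · intro H f g hf hg hfg
    obtain ⟨w, hw⟩ := exists_matchPair_eq hf hg
    obtain rfl : w = 0 := by
      by_contra hw0
      refine H ⟨w, hw0, funext fun i => ?_⟩
      rw [hrow, hw]
      simp [hfg]
    obtain ⟨h₁, h₂⟩ := Prod.ext_iff.mp hw
    simp only [matchPair, Pi.zero_apply, map_zero, zero_mul, Finset.sum_const_zero] at h₁ h₂
    exact ⟨g.coeff 0, sub_eq_zero.mp h₁.symm, sub_eq_zero.mp h₂.symm⟩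

/-- The limit of the conditions `f (x (I j)) = g (x (J j))`, for `f` and `g` of degree at most `a`
and `b`, as the point `x v` tends to infinity: conditions that involve `x v` become conditions on
the top coefficients of `f` and `g`. -/
structure IsMatchAtInfinity (E : Finset ρ) (I J : ρ → V) (a b : ℕ) (x : V → K) (v : V)
    (f g : K[X]) : Prop where
  eval_eq : ∀ j ∈ E, I j ≠ v → J j ≠ v → f.eval (x (I j)) = g.eval (x (J j))
  coeff_left : ∀ j ∈ E, I j = v → J j ≠ v → f.coeff a = 0
  coeff_right : ∀ j ∈ E, I j ≠ v → J j = v → g.coeff b = 0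
  coeff_loop : ∀ j ∈ E, I j = v → J j = v → (f - g).coeff (max a b) = 0

theorem coeff_aeval_matchPair_sub_eq_zero {y z : K[X]} {w : Fin (a + 1) ⊕ Fin b → K[X]}
    (hw : ∑ c, matchRow a b y z c * w c = 0) {D d : ℕ} (hD : ∀ c, (w c).natDegree ≤ D)
    (hd : ∀ c, (matchRow a b y z c).natDegree ≤ d) :
    (aeval y (matchPair fun c => (w c).coeff D).1
      - aeval z (matchPair fun c => (w c).coeff D).2).coeff d = 0 := by
  rw [← sum_smul_matchRow, finsetSum_coeff]
  have htop := coeff_sum_mul_add hd hD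
  rw [hw, coeff_zero] at htop
  simpa only [coeff_smul, smul_eq_mul, coeff_C_mul, mul_comm] using htop.symm

theorem natDegree_matchRow_le {y z : K[X]} {d : ℕ} (hy : a * y.natDegree ≤ d)
    (hz : b * z.natDegree ≤ d) (c : Fin (a + 1) ⊕ Fin b) :
    (matchRow a b y z c).natDegree ≤ d := by
  rcases c with r | r
  · exact natDegree_pow_le.trans ((Nat.mul_le_mul_right _ (by omega)).trans hy)
  · refine (natDegree_neg _).le.trans (natDegree_pow_le.trans ?_)
    exact (Nat.mul_le_mul_right _ (by omega)).trans hz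

theorem isMatchAtInfinity_matchPair [DecidableEq V] (ha : 1 ≤ a) (hb : 1 ≤ b) {x : V → K} {v : V}
    {w : Fin (a + 1) ⊕ Fin b → K[X]} {D : ℕ} (hD : ∀ c, (w c).natDegree ≤ D)
    (hw : ∀ j ∈ E, ∑ c, matchRow a b (Function.update (fun u => C (x u)) v X (I j))
      (Function.update (fun u => C (x u)) v X (J j)) c * w c = 0) :
    IsMatchAtInfinity E I J a b x v (matchPair fun c => (w c).coeff D).1
      (matchPair fun c => (w c).coeff D).2 := by
  have haeval (y : K) (f : K[X]) : aeval (C y) f = C (f.eval y) := by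
    rw [← algebraMap_eq, aeval_algebraMap_apply, coe_aeval_eq_eval]
  constructor <;> intro j hj hI hJ <;> have hrow := hw j hj <;>
    simp only [hI, hJ, Function.update_self, ne_eq, not_false_eq_true,
      Function.update_of_ne] at hrow
  · have := coeff_aeval_matchPair_sub_eq_zero hrow hD (d := 0)
      (natDegree_matchRow_le (by simp) (by simp))
    simpa [haeval, sub_eq_zero] using this
  · have := coeff_aeval_matchPair_sub_eq_zero hrow hD (d := a)
      (natDegree_matchRow_le (by simp) (by simp))
    simpa [haeval, coeff_C, Nat.ne_of_gt ha] using this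
  · have := coeff_aeval_matchPair_sub_eq_zero hrow hD (d := b)
      (natDegree_matchRow_le (by simp) (by simp))
    simpa [haeval, coeff_C, Nat.ne_of_gt hb] using this
  · have := coeff_aeval_matchPair_sub_eq_zero hrow hD (d := max a b)
      (natDegree_matchRow_le (by simp) (by simp))
    simpa using this

theorem exists_update_onlyConstMatch [DecidableEq V] [Infinite K] (hcard : E.card = a + b + 1)
    (ha : 1 ≤ a) (hb : 1 ≤ b) (v : V) (x : V → K)
    (H : ∀ f g : K[X], f.natDegree ≤ a → g.natDegree ≤ b → IsMatchAtInfinity E I J a b x v f g →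
      ∃ c, f = C c ∧ g = C c) :
    ∃ t, OnlyConstMatch E I J a b (Function.update x v t) := by
  by_contra! hall
  obtain ⟨ε⟩ : Nonempty (Fin (a + 1) ⊕ Fin b ≃ E) :=
    Fintype.card_eq.mp (by simp [hcard]; omega)
  set y : V → K[X] := Function.update (fun u => C (x u)) v X
  have heval (t : K) : (fun u => (y u).eval t) = Function.update x v t := by
    funext u
    obtain rfl | hu := eq_or_ne u v
    · simp [y]
    · simp [y, hu]
  have hdet : (matchMatrix a b (fun i => I (ε i)) (fun i => J (ε i)) y).det = 0 := by
    refine Polynomial.funext fun t => ?_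
    rw [← coe_evalRingHom, RingHom.map_det, RingHom.mapMatrix_apply, map_matchMatrix, map_zero]
    simpa [onlyConstMatch_iff_det_ne_zero ε, heval] using hall t
  obtain ⟨w, hw0, hw⟩ := Matrix.exists_mulVec_eq_zero_iff.mpr hdet
  obtain ⟨D, hD, hwD⟩ := exists_coeff_ne_zero_natDegree_le hw0
  obtain ⟨c, h₁, h₂⟩ := H _ _ (natDegree_matchPair_fst_le _) (natDegree_matchPair_snd_le _)
    (isMatchAtInfinity_matchPair ha hb hD fun j hj => by
      simpa [Matrix.mulVec, dotProduct, matchMatrix] using congrFun hw (ε.symm ⟨j, hj⟩))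
  exact hwD (eq_zero_of_matchPair_eq_C h₁ h₂)

end OnlyConstMatch

section Cycles

variable {V ρ : Type*} [DecidableEq V] {E E' S U : Finset ρ} {I J : ρ → V} {m m' : ℕ}
  {𝒮 : Finset (Finset ρ)}

/-- A family of pairwise disjoint nonempty subsets of `E` on each of which `I` and `J` have the same
image. When `j ∈ E` is read as an edge from `I j` to `J j`, and `I` and `J` are injective on `E`,
these are unions of directed cycles. -/
structure IsCycleFamily (E : Finset ρ) (I J : ρ → V) (𝒮 : Finset (Finset ρ)) : Prop where
  subset : ∀ S ∈ 𝒮, S ⊆ E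
  nonempty : ∀ S ∈ 𝒮, S.Nonempty
  image_eq : ∀ S ∈ 𝒮, S.image I = S.image J
  disjoint : (𝒮 : Set (Finset ρ)).PairwiseDisjoint id

theorem IsCycleFamily.mono (h : IsCycleFamily E' I J 𝒮) (hE : E' ⊆ E) : IsCycleFamily E I J 𝒮 :=
  ⟨fun S hS => (h.subset S hS).trans hE, h.nonempty, h.image_eq, h.disjoint⟩

/-- There are at most `m` disjoint cycles among the edges from `I j` to `J j`, `j ∈ E`. -/
def CycleBound (E : Finset ρ) (I J : ρ → V) (m : ℕ) : Prop :=
  ∀ 𝒮, IsCycleFamily E I J 𝒮 → 𝒮.card ≤ m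

theorem CycleBound.mono (h : CycleBound E I J m) (hE : E' ⊆ E) (hm : m ≤ m') :
    CycleBound E' I J m' :=
  fun 𝒮 h𝒮 => (h 𝒮 (h𝒮.mono hE)).trans hm

theorem CycleBound.symm (h : CycleBound E I J m) : CycleBound E J I m := fun 𝒮 h𝒮 =>
  h 𝒮 ⟨h𝒮.subset, h𝒮.nonempty, fun S hS => (h𝒮.image_eq S hS).symm, h𝒮.disjoint⟩

theorem exists_notMem_image (hI : Set.InjOn I E)
    (hloops : ∀ S ⊆ E, S.image I = S.image J → ∀ j ∈ S, I j = J j)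
    (hne : ∃ j ∈ E, I j ≠ J j) : ∃ j ∈ E, I j ∉ E.image J := by
  obtain ⟨i, hi, hIJ⟩ := hne
  set N := E.filter fun j => I j ≠ J j
  have hNE : N ⊆ E := Finset.filter_subset _ _
  have hN : ¬ N.image I ⊆ N.image J := fun hsub => by
    refine hIJ (hloops N hNE (Finset.eq_of_subset_of_card_le hsub ?_) i
      (Finset.mem_filter.mpr ⟨hi, hIJ⟩))
    rw [Finset.card_image_of_injOn (hI.mono (Finset.coe_subset.mpr hNE))]
    exact Finset.card_image_le
  obtain ⟨v, hv, hvJ⟩ := Finset.not_subset.mp hN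
  obtain ⟨j, hj, rfl⟩ := Finset.mem_image.mp hv
  refine ⟨j, hNE hj, fun hmem => ?_⟩
  obtain ⟨j', hj', hJj'⟩ := Finset.mem_image.mp hmem
  have hloop : I j' = J j' := by
    by_contra hne
    exact hvJ (Finset.mem_image.mpr ⟨j', Finset.mem_filter.mpr ⟨hj', hne⟩, hJj'⟩)
  obtain rfl := hI hj' (hNE hj) (hloop.trans hJj')
  exact (Finset.mem_filter.mp hj).2 hloop

theorem CycleBound.card_filter_loop_le (h : CycleBound E I J m) :
    (E.filter fun j => I j = J j).card ≤ m := by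
  classical
  rw [← Finset.card_image_of_injective _ Finset.singleton_injective]
  refine h _ ⟨?_, ?_, ?_, ?_⟩
  · exact Finset.forall_mem_image.mpr (by simp +contextual)
  · exact Finset.forall_mem_image.mpr (by simp)
  · exact Finset.forall_mem_image.mpr (by simp +contextual)
  · intro S hS T hT hST
    simp only [Finset.coe_image, Set.mem_image] at hS hT
    obtain ⟨i, -, rfl⟩ := hS
    obtain ⟨j, -, rfl⟩ := hT
    simpa [Function.onFun] using fun h : i = j => hST (by rw [h])

theorem image_sdiff_subset_of_image_eq [DecidableEq ρ] (hI : Set.InjOn I E) (hS : S ⊆ E)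
    (hU : U ⊆ E) (hSi : S.image I = S.image J) (hUi : U.image I = U.image J) :
    (S \ U).image I ⊆ (S \ U).image J := by
  intro v hv
  obtain ⟨s, hs, rfl⟩ := Finset.mem_image.mp hv
  obtain ⟨hsS, hsU⟩ := Finset.mem_sdiff.mp hs
  obtain ⟨s', hs', hJs'⟩ := Finset.mem_image.mp (hSi ▸ Finset.mem_image_of_mem I hsS)
  refine Finset.mem_image.mpr ⟨s', Finset.mem_sdiff.mpr ⟨hs', fun hs'U => hsU ?_⟩, hJs'⟩
  obtain ⟨u, hu, hIu⟩ := Finset.mem_image.mp (hUi.symm ▸ Finset.mem_image_of_mem J hs'U)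
  rwa [← hI (hU hu) (hS hsS) (hIu.trans hJs')]

theorem IsCycleFamily.exists_insert (hI : Set.InjOn I E) (hJ : Set.InjOn J E)
    (h : IsCycleFamily E' I J 𝒮) (hE : E' ⊆ E) (hS : S ⊆ E) (hSi : S.image I = S.image J) {j : ρ}
    (hj : j ∈ S) (hjE : j ∉ E') : ∃ 𝒯, IsCycleFamily E I J 𝒯 ∧ 𝒯.card = 𝒮.card + 1 := by
  classical
  set U := 𝒮.biUnion id
  have hUE' : U ⊆ E' := Finset.biUnion_subset.mpr h.subset
  have hUi : U.image I = U.image J := by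
    simp only [U, Finset.biUnion_image]
    exact Finset.biUnion_congr rfl h.image_eq
  have hjSU : j ∈ S \ U := Finset.mem_sdiff.mpr ⟨hj, fun hjU => hjE (hUE' hjU)⟩
  have hSUi : (S \ U).image I = (S \ U).image J :=
    (image_sdiff_subset_of_image_eq hI hS (hUE'.trans hE) hSi hUi).antisymm
      (image_sdiff_subset_of_image_eq hJ hS (hUE'.trans hE) hSi.symm hUi.symm)
  have hnotMem : S \ U ∉ 𝒮 := fun hmem => hjE (h.subset _ hmem hjSU)
  have h' := h.mono hE
  refine ⟨insert (S \ U) 𝒮, ⟨?_, ?_, ?_, ?_⟩, Finset.card_insert_of_notMem hnotMem⟩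
  · exact Finset.forall_mem_insert _ _ _ |>.mpr ⟨Finset.sdiff_subset.trans hS, h'.subset⟩
  · exact Finset.forall_mem_insert _ _ _ |>.mpr ⟨⟨j, hjSU⟩, h'.nonempty⟩
  · exact Finset.forall_mem_insert _ _ _ |>.mpr ⟨hSUi, h'.image_eq⟩
  · rw [Finset.coe_insert]
    refine h'.disjoint.insert fun T hT _ => Finset.disjoint_left.mpr fun i hi hiT => ?_
    exact (Finset.mem_sdiff.mp hi).2 (Finset.mem_biUnion.mpr ⟨T, hT, hiT⟩)

theorem CycleBound.sub_one (h : CycleBound E I J m) (hI : Set.InjOn I E) (hJ : Set.InjOn J E)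
    (hE : E' ⊆ E) (hS : S ⊆ E) (hSi : S.image I = S.image J) {j : ρ} (hj : j ∈ S)
    (hjE : j ∉ E') : CycleBound E' I J (m - 1) := fun 𝒮 h𝒮 => by
  obtain ⟨𝒯, h𝒯, hcard⟩ := h𝒮.exists_insert hI hJ hE hS hSi hj hjE
  exact Nat.le_sub_one_of_lt (hcard.ge.trans (h 𝒯 h𝒯))

end Cycles

section GenericMatch

variable (K : Type*) [Field K] {V ρ : Type*} [DecidableEq V] {a b : ℕ}
  {E : Finset ρ} {I J : ρ → V} {j : ρ}

/-- For every `a + b + 1` edges with at most `max a b` disjoint cycles there is a point at which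
only equal constants of degrees at most `a` and `b` match. -/
def GenericMatch (V ρ : Type*) [DecidableEq V] (a b : ℕ) : Prop :=
  ∀ (E : Finset ρ) (I J : ρ → V), Set.InjOn I E → Set.InjOn J E →
    E.card = a + b + 1 → CycleBound E I J (max a b) → ∃ x : V → K, OnlyConstMatch E I J a b x

variable {K}

theorem GenericMatch.symm (h : GenericMatch K V ρ a b) : GenericMatch K V ρ b a := by
  intro E I J hI hJ hcard hcyc
  obtain ⟨x, hx⟩ := h E J I hJ hI (by omega) (max_comm a b ▸ hcyc.symm)
  refine ⟨x, fun f g hf hg hfg => ?_⟩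
  obtain ⟨c, hgc, hfc⟩ := hx g f hg hf fun j hj => (hfg j hj).symm
  exact ⟨c, hfc, hgc⟩

variable [Infinite K]

theorem genericMatch_zero (a : ℕ) : GenericMatch K V ρ a 0 := by
  classical
  intro E I J hI _ hcard _
  obtain ⟨x, -, hx⟩ : ∃ x : V → K, ↑(E.image I) ⊆ x ⁻¹' Set.univ ∧ Set.InjOn x (E.image I) :=
    (E.image I).finite_toSet.exists_injOn_of_encard_le (by simp)
  have hxI : Set.InjOn (fun j => x (I j)) E :=
    hx.comp hI fun j hj => Finset.mem_coe.mpr (Finset.mem_image_of_mem I hj)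
  refine ⟨x, fun f g hf hg hfg => ?_⟩
  obtain ⟨c, rfl⟩ := natDegree_eq_zero.mp (Nat.le_zero.mp hg)
  refine ⟨c, sub_eq_zero.mp ?_, rfl⟩
  refine eq_zero_of_natDegree_lt_card_of_eval_eq_zero' _ (E.image fun j => x (I j)) ?_ ?_
  · simp +contextual [hfg]
  · rw [Finset.card_image_of_injOn hxI, hcard, natDegree_sub_C]
    omega

theorem exists_onlyConstMatch_of_source [DecidableEq ρ] (ha : 1 ≤ a) (hb : 1 ≤ b)
    (ih : GenericMatch K V ρ (a - 1) b) (hI : Set.InjOn I E) (hJ : Set.InjOn J E)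
    (hcard : E.card = a + b + 1) (hj : j ∈ E) (hsource : I j ∉ E.image J)
    (hcyc : CycleBound (E.erase j) I J (max (a - 1) b)) :
    ∃ x : V → K, OnlyConstMatch E I J a b x := by
  have hsub : (E.erase j : Set ρ) ⊆ E := Finset.coe_subset.mpr (Finset.erase_subset j E)
  obtain ⟨x, hx⟩ := ih (E.erase j) I J (hI.mono hsub) (hJ.mono hsub)
    (by rw [Finset.card_erase_of_mem hj]; omega) hcyc
  have hJne (i) (hi : i ∈ E) : J i ≠ I j := fun h => hsource (h ▸ Finset.mem_image_of_mem J hi)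
  refine (exists_update_onlyConstMatch hcard ha hb (I j) x fun f g hf hg hfg => ?_).imp' _
    fun _ => id
  have hf' := natDegree_le_pred hf (hfg.coeff_left j hj rfl (hJne j hj))
  refine hx f g hf' hg fun i hi => ?_
  obtain ⟨hij, hiE⟩ := Finset.mem_erase.mp hi
  exact hfg.eval_eq i hiE (hij ∘ hI hiE hj) (hJne i hiE)

theorem exists_onlyConstMatch_of_loop [DecidableEq ρ] (hb : 1 ≤ b) (hab : b < a)
    (ih : GenericMatch K V ρ (a - 1) b) (hI : Set.InjOn I E) (hJ : Set.InjOn J E)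
    (hcard : E.card = a + b + 1) (hj : j ∈ E) (hloop : I j = J j)
    (hcyc : CycleBound (E.erase j) I J (max (a - 1) b)) :
    ∃ x : V → K, OnlyConstMatch E I J a b x := by
  have hsub : (E.erase j : Set ρ) ⊆ E := Finset.coe_subset.mpr (Finset.erase_subset j E)
  obtain ⟨x, hx⟩ := ih (E.erase j) I J (hI.mono hsub) (hJ.mono hsub)
    (by rw [Finset.card_erase_of_mem hj]; omega) hcyc
  refine (exists_update_onlyConstMatch hcard (hb.trans hab.le) hb (I j) x
    fun f g hf hg hfg => ?_).imp' _ fun _ => id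
  have hfa : f.coeff a = 0 := by
    simpa [max_eq_left hab.le, coeff_eq_zero_of_natDegree_lt (hg.trans_lt hab)]
      using hfg.coeff_loop j hj rfl hloop.symm
  refine hx f g (natDegree_le_pred hf hfa) hg fun i hi => ?_
  obtain ⟨hij, hiE⟩ := Finset.mem_erase.mp hi
  exact hfg.eval_eq i hiE (hij ∘ hI hiE hj) fun h => hij (hJ hiE hj (h.trans hloop))

theorem exists_onlyConstMatch_of_passing [DecidableEq ρ] (ha : 1 ≤ a) (hb : 1 ≤ b)
    (ih : GenericMatch K V ρ (a - 1) (b - 1)) (hI : Set.InjOn I E) (hJ : Set.InjOn J E)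
    (hcard : E.card = a + b + 1) {j' : ρ} (hj : j ∈ E) (hj' : j' ∈ E) (hne : I j ≠ J j)
    (hpass : J j' = I j) (hcyc : CycleBound ((E.erase j).erase j') I J (max (a - 1) (b - 1))) :
    ∃ x : V → K, OnlyConstMatch E I J a b x := by
  have hjj' : j' ≠ j := fun h => hne (by rw [← hpass, h])
  have hsub : ((E.erase j).erase j' : Set ρ) ⊆ E :=
    Finset.coe_subset.mpr ((Finset.erase_subset _ _).trans (Finset.erase_subset j E))
  obtain ⟨x, hx⟩ := ih _ I J (hI.mono hsub) (hJ.mono hsub) (by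
    rw [Finset.card_erase_of_mem (Finset.mem_erase.mpr ⟨hjj', hj'⟩), Finset.card_erase_of_mem hj]
    omega) hcyc
  refine (exists_update_onlyConstMatch hcard ha hb (I j) x fun f g hf hg hfg => ?_).imp' _
    fun _ => id
  have hf' := natDegree_le_pred hf (hfg.coeff_left j hj rfl hne.symm)
  have hg' := natDegree_le_pred hg (hfg.coeff_right j' hj' (hjj' ∘ hI hj' hj) hpass)
  refine hx f g hf' hg' fun i hi => ?_
  obtain ⟨hij', hij, hiE⟩ : i ≠ j' ∧ i ≠ j ∧ i ∈ E := by simpa using hi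
  exact hfg.eval_eq i hiE (hij ∘ hI hiE hj) fun h => hij' (hJ hiE hj' (h.trans hpass.symm))

theorem genericMatch_of_le (hab : b ≤ a)
    (ih : ∀ a' b', a' + b' < a + b → GenericMatch K V ρ a' b') : GenericMatch K V ρ a b := by
  classical
  obtain rfl | hb := Nat.eq_zero_or_pos b
  · exact genericMatch_zero a
  intro E I J hI hJ hcard hcyc
  by_cases hloops : ∀ S ⊆ E, S.image I = S.image J → ∀ j ∈ S, I j = J j
  · by_cases hloop : b < a ∧ ∃ j ∈ E, I j = J j
    · obtain ⟨hlt, j, hj, hIJ⟩ := hloop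
      refine exists_onlyConstMatch_of_loop hb hlt (ih _ _ (by omega)) hI hJ hcard hj hIJ ?_
      exact (hcyc.sub_one hI hJ (Finset.erase_subset j E) (Finset.singleton_subset_iff.mpr hj)
        (by simp [hIJ]) (Finset.mem_singleton_self j) (by simp)).mono subset_rfl (by omega)
    · have hnonloop : ∃ j ∈ E, I j ≠ J j := by
        by_contra! hall
        have := hcyc.card_filter_loop_le
        rw [Finset.filter_true_of_mem hall] at this
        omega
      obtain ⟨j, hj, hsource⟩ := exists_notMem_image hI hloops hnonloop
      refine exists_onlyConstMatch_of_source (Nat.le_trans hb hab) hb (ih _ _ (by omega)) hI hJ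
        hcard hj hsource ?_
      obtain rfl | hlt := hab.eq_or_lt
      · exact hcyc.mono (Finset.erase_subset j E) (by omega)
      · intro 𝒮 h𝒮
        replace h𝒮 := h𝒮.mono (Finset.erase_subset j E)
        suffices 𝒮 = ∅ by simp [this]
        refine Finset.eq_empty_of_forall_notMem fun S hS => hloop ⟨hlt, ?_⟩
        obtain ⟨i, hi⟩ := h𝒮.nonempty S hS
        exact ⟨i, h𝒮.subset S hS hi, hloops S (h𝒮.subset S hS) (h𝒮.image_eq S hS) i hi⟩
  · push Not at hloops
    obtain ⟨S, hS, hSi, j, hj, hne⟩ := hloops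
    obtain ⟨j', hj', hpass⟩ := Finset.mem_image.mp (hSi ▸ Finset.mem_image_of_mem I hj)
    refine exists_onlyConstMatch_of_passing (Nat.le_trans hb hab) hb (ih _ _ (by omega)) hI hJ hcard
      (hS hj) (hS hj') hne hpass ?_
    exact (hcyc.sub_one hI hJ ((Finset.erase_subset _ _).trans (Finset.erase_subset j E)) hS hSi hj
      (by simp)).mono subset_rfl (by omega)

theorem genericMatch (a b : ℕ) : GenericMatch K V ρ a b := by
  induction hN : a + b using Nat.strong_induction_on generalizing a b with
  | _ N ih =>
    subst hN
    obtain hab | hab := le_total b a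
    · exact genericMatch_of_le hab fun a' b' hlt => ih _ hlt a' b' rfl
    · exact (genericMatch_of_le hab fun a' b' hlt => ih _ (by omega) a' b' rfl).symm

end GenericMatch

section PowerSums

variable {V A B : Type*} [CommRing A] [CommRing B] {k : ℕ} {T : Fin k → Finset V}

/-- The matrix of the power sums of orders `0, …, k - 1` of the points `x` over the sets `T t`. -/
def powerSumMatrix (T : Fin k → Finset V) (x : V → A) : Matrix (Fin k) (Fin k) A :=
  Matrix.of fun t r => ∑ v ∈ T t, x v ^ (r : ℕ)

theorem aeval_det_powerSumMatrix_X [Algebra A B] (x : V → B) :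
    MvPolynomial.aeval x (powerSumMatrix T (MvPolynomial.X (R := A))).det
      = (powerSumMatrix T x).det := by
  rw [AlgHom.map_det, AlgHom.mapMatrix_apply]
  congr 1
  ext t r
  simp [powerSumMatrix]

theorem card_support_det_powerSumMatrix_X_le :
    (powerSumMatrix T (MvPolynomial.X (R := A))).det.support.card ≤ k ! * ∏ t, (T t).card := by
  classical
  refine (card_support_det_le _ (fun t => (T t).card) fun t r => ?_).trans_eq (by simp)
  refine (Finset.card_le_card MvPolynomial.support_sum).trans
    (Finset.card_biUnion_le_card_mul _ _ 1 fun v _ => ?_) |>.trans_eq (mul_one _)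
  rw [MvPolynomial.X_pow_eq_monomial]
  exact (Finset.card_le_card MvPolynomial.support_monomial_subset).trans (by simp)

theorem totalDegree_det_powerSumMatrix_X_le :
    (powerSumMatrix T (MvPolynomial.X (R := A))).det.totalDegree ≤ k * (k - 1) := by
  have hdet := totalDegree_det_le (powerSumMatrix T (MvPolynomial.X (R := A)))
    (fun _ => k - 1) fun t r => MvPolynomial.totalDegree_finsetSum_le fun v _ => by
      rw [MvPolynomial.X_pow_eq_monomial]
      exact (MvPolynomial.totalDegree_monomial_le _ _).trans (by simp; omega)
  simpa using hdet

theorem det_powerSumMatrix_of_forall_eq {x : V → A} {c : Fin k → A}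
    (hx : ∀ t, ∀ v ∈ T t, x v = c t) :
    (powerSumMatrix T x).det = (∏ t, ((T t).card : A)) * (Matrix.vandermonde c).det := by
  rw [← Matrix.det_mul_column]
  congr 1
  ext t r
  simp only [powerSumMatrix, Matrix.of_apply, Matrix.vandermonde_apply]
  rw [Finset.sum_congr rfl fun v hv => by rw [hx t v hv], Finset.sum_const, nsmul_eq_mul]

theorem exists_forall_eq_of_pairwise_disjoint (hT : Pairwise fun s t => Disjoint (T s) (T t))
    (c : Fin k → A) : ∃ x : V → A, ∀ t, ∀ v ∈ T t, x v = c t := by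
  classical
  refine ⟨fun v => ∑ t, if v ∈ T t then c t else 0, fun t v hv => ?_⟩
  dsimp only
  rw [Fintype.sum_eq_single t fun s hs => if_neg fun hvs =>
    Finset.disjoint_left.mp (hT hs) hvs hv, if_pos hv]

theorem det_powerSumMatrix_X_ne_zero [IsDomain A]
    (hT : Pairwise fun s t => Disjoint (T s) (T t)) (hcard : ∀ t, ((T t).card : A) ≠ 0)
    {c : Fin k → A} (hc : Function.Injective c) :
    (powerSumMatrix T (MvPolynomial.X (R := A))).det ≠ 0 := by
  obtain ⟨x, hx⟩ := exists_forall_eq_of_pairwise_disjoint hT c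
  refine ne_zero_of_map (f := MvPolynomial.aeval (R := A) x) ?_
  rw [aeval_det_powerSumMatrix_X, det_powerSumMatrix_of_forall_eq hx]
  exact mul_ne_zero (Finset.prod_ne_zero_iff.mpr fun t _ => hcard t)
    (Matrix.det_vandermonde_ne_zero_iff.mpr hc)

theorem eq_zero_of_sum_eval_eq_zero [IsDomain A] {x : V → A}
    (hdet : (powerSumMatrix T x).det ≠ 0) {f : A[X]} (hf : f.degree < k)
    (h : ∀ t, ∑ v ∈ T t, f.eval (x v) = 0) : f = 0 := by
  have heval (y : A) : f.eval y = ∑ r : Fin k, f.coeff r * y ^ (r : ℕ) := by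
    rw [eval_eq_sum_degreeLTEquiv (mem_degreeLT.mpr hf)]
    rfl
  have hcoeff := Matrix.eq_zero_of_mulVec_eq_zero hdet (v := fun r : Fin k => f.coeff r) <| by
    funext t
    rw [Pi.zero_apply, ← h t]
    simp only [heval]
    rw [Finset.sum_comm]
    simp [Matrix.mulVec, dotProduct, powerSumMatrix, Finset.mul_sum, mul_comm]
  ext m
  obtain hm | hm := lt_or_ge m k
  · exact congrFun hcoeff ⟨m, hm⟩
  · exact coeff_eq_zero_of_degree_lt (hf.trans_le (by exact_mod_cast hm))

theorem factorial_mul_prod_le {m : Fin k → ℕ} (hpos : ∀ t, 1 ≤ m t)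
    (hsum : ∑ t, m t ≤ 2 * k - 1) : k ! * ∏ t, m t ≤ (2 * k - 1)! := by
  obtain rfl | hk := Nat.eq_zero_or_pos k
  · simp
  have hexp : ∑ t, (m t - 1) ≤ k - 1 := by
    have hsplit : ∑ t, (m t - 1) + k = ∑ t, m t := by
      rw [← Finset.sum_congr rfl fun t _ => Nat.sub_add_cancel (hpos t), Finset.sum_add_distrib]
      simp
    omega
  have hprod : ∏ t, m t ≤ (k + 1) ^ (k - 1) :=
    calc ∏ t, m t ≤ ∏ t, 2 ^ (m t - 1) :=
          Finset.prod_le_prod' fun t _ => Nat.le_of_pred_lt (m t - 1).lt_two_pow_self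
      _ = 2 ^ ∑ t, (m t - 1) := Finset.prod_pow_eq_pow_sum _ _ _
      _ ≤ 2 ^ (k - 1) := Nat.pow_le_pow_right two_pos hexp
      _ ≤ (k + 1) ^ (k - 1) := Nat.pow_le_pow_left (by omega) _
  calc k ! * ∏ t, m t ≤ k ! * (k + 1) ^ (k - 1) := Nat.mul_le_mul_left _ hprod
    _ ≤ (k + (k - 1))! := Nat.factorial_mul_pow_le_factorial
    _ = (2 * k - 1)! := by congr 1; omega

end PowerSums

section Separation

/-- Two polynomials of degree less than `k` whose values agree along some matching of `r` of the
points `α` with `r` of these points are equal. -/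
def SeparatesPolys {F : Type*} [Field F] {n : ℕ} (k r : ℕ) (α : Fin n → F) : Prop :=
  ∀ f g : F[X], f.degree < k → g.degree < k → ∀ I J : Fin r → Fin n, Function.Injective I →
    Function.Injective J → (∀ j, f.eval (α (I j)) = g.eval (α (J j))) → f = g

theorem onlyConstMatch_of_cycleBound {R F V ρ : Type*} [Field R] [Field F] [Algebra R F]
    [DecidableEq V] {α : V → F} {a b d s : ℕ} {E : Finset ρ} {I J : ρ → V}
    (hα : SparselyIndependent R α d s) (hd : a * (a + 1) + b * (b + 1) < 2 * d)
    (hs : (a + b + 1)! ≤ s) (hI : Set.InjOn I E) (hJ : Set.InjOn J E)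
    (hcard : E.card = a + b + 1) (hcyc : CycleBound E I J (max a b)) :
    OnlyConstMatch E I J a b α := by
  obtain ⟨ε⟩ : Nonempty (Fin (a + 1) ⊕ Fin b ≃ E) :=
    Fintype.card_eq.mp (by simp [hcard]; omega)
  obtain ⟨x, hx⟩ := genericMatch (K := AlgebraicClosure R) a b E I J hI hJ hcard hcyc
  rw [onlyConstMatch_iff_det_ne_zero ε, ← aeval_det_matchMatrix_X (A := R)] at hx ⊢
  refine hα _ (ne_zero_of_map hx) ?_ ?_
  · have := totalDegree_det_matchMatrix_X_le (A := R) (fun i => I (ε i)) fun i => J (ε i)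
    omega
  · refine (card_support_det_le _ _ (card_support_matchRow_X_le _ _)).trans (le_trans ?_ hs)
    simp [show a + 1 + b = a + b + 1 by omega]

theorem det_powerSumMatrix_ne_zero {R F V : Type*} [Field R] [Field F] [Algebra R F]
    {α : V → F} {d s k : ℕ} {T : Fin k → Finset V} (hα : SparselyIndependent R α d s)
    (hd : k * (k - 1) < d) (hs : k ! * ∏ t, (T t).card ≤ s)
    (hT : Pairwise fun s t => Disjoint (T s) (T t)) (hcard : ∀ t, ((T t).card : R) ≠ 0)
    {c : Fin k → R} (hc : Function.Injective c) : (powerSumMatrix T α).det ≠ 0 := by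
  rw [← aeval_det_powerSumMatrix_X (A := R)]
  exact hα _ (det_powerSumMatrix_X_ne_zero hT hcard hc)
    (totalDegree_det_powerSumMatrix_X_le.trans_lt hd)
    (card_support_det_powerSumMatrix_X_le.trans hs)

theorem sum_image_eval_sub_eq_zero {A V ρ : Type*} [CommRing A] [DecidableEq V] {α : V → A}
    {S : Finset ρ} {I J : ρ → V} (hI : Set.InjOn I S) (hJ : Set.InjOn J S)
    (hS : S.image I = S.image J) {f g : A[X]}
    (hfg : ∀ j ∈ S, f.eval (α (I j)) = g.eval (α (J j))) :
    ∑ v ∈ S.image I, (f - g).eval (α v) = 0 := by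
  simp only [eval_sub, Finset.sum_sub_distrib]
  nth_rewrite 2 [hS]
  rw [Finset.sum_image hI, Finset.sum_image hJ, Finset.sum_congr rfl hfg, sub_self]

variable {R F : Type*} [Field R] [Field F] [Algebra R F] {n k : ℕ} {α : Fin n → F}

theorem eq_of_not_cycleBound (hα : SparselyIndependent R α (k ^ 2) (2 * k - 1)!) (hk : 1 ≤ k)
    (p : ℕ) [CharP R p] (hp : 2 * k - 1 < p) {I J : Fin (2 * k - 1) → Fin n}
    (hI : Function.Injective I) (hJ : Function.Injective J)
    (hcyc : ¬ CycleBound Finset.univ I J (k - 1)) {f g : F[X]} (hf : f.degree < k)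
    (hg : g.degree < k) (hfg : ∀ j, f.eval (α (I j)) = g.eval (α (J j))) : f = g := by
  simp only [CycleBound, not_forall, not_le] at hcyc
  obtain ⟨𝒮, h𝒮, hcard⟩ := hcyc
  obtain ⟨S⟩ : Nonempty (Fin k ↪ 𝒮) :=
    Function.Embedding.nonempty_of_card_le (by simp; omega)
  have hSdisj : Pairwise fun s t => Disjoint (S s).1 (S t).1 := fun s t hst =>
    h𝒮.disjoint (S s).2 (S t).2 fun heq => hst (S.injective (Subtype.ext heq))
  have hSpos (t) : 1 ≤ (S t).1.card := Finset.card_pos.mpr (h𝒮.nonempty _ (S t).2)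
  have hTcard (t) : ((S t).1.image I).card = (S t).1.card := Finset.card_image_of_injective _ hI
  have hSsum : ∑ t, (S t).1.card ≤ 2 * k - 1 := by
    rw [← Finset.card_biUnion fun s _ t _ hst => hSdisj hst]
    exact (Finset.card_le_univ _).trans (by simp)
  have hdet : (powerSumMatrix (fun t => (S t).1.image I) α).det ≠ 0 := by
    refine det_powerSumMatrix_ne_zero hα ?_ ?_ ?_ ?_ (c := fun t : Fin k => ((t : ℕ) : R)) ?_
    · rw [sq]
      exact Nat.mul_lt_mul_of_pos_left (by omega) hk
    · simpa only [hTcard] using factorial_mul_prod_le hSpos hSsum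
    · exact fun s t hst => (Finset.disjoint_image hI).mpr (hSdisj hst)
    · intro t h0
      rw [hTcard, CharP.cast_eq_zero_iff R p] at h0
      have hle : (S t).1.card ≤ 2 * k - 1 := (Finset.card_le_univ _).trans (by simp)
      exact (Nat.le_of_dvd (hSpos t) h0).not_gt (hle.trans_lt hp)
    · exact fun s t hst => Fin.ext
        (CharP.natCast_injOn_Iio R p (s.2.trans (by omega)) (t.2.trans (by omega)) hst)
  have hdeg : (f - g).degree < k := (degree_sub_le f g).trans_lt (max_lt hf hg)
  refine sub_eq_zero.mp (eq_zero_of_sum_eval_eq_zero hdet hdeg fun t => ?_)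
  exact sum_image_eval_sub_eq_zero hI.injOn hJ.injOn (h𝒮.image_eq _ (S t).2) fun j _ => hfg j

theorem SparselyIndependent.separatesPolys
    (hα : SparselyIndependent R α (k ^ 2) (2 * k - 1)!) (hk : 1 ≤ k) (p : ℕ) [CharP R p]
    (hp : 2 * k - 1 < p) : SeparatesPolys k (2 * k - 1) α := by
  intro f g hf hg I J hI hJ hfg
  by_cases hcyc : CycleBound Finset.univ I J (k - 1)
  · obtain ⟨l, rfl⟩ : ∃ l, k = l + 1 := ⟨k - 1, by omega⟩
    have hmatch : OnlyConstMatch Finset.univ I J l l α :=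
      onlyConstMatch_of_cycleBound hα (by nlinarith) (Nat.factorial_le (by omega)) hI.injOn
        hJ.injOn (by simp; omega) (by simpa using hcyc)
    have hnat {f : F[X]} (hf : f.degree < (l + 1 : ℕ)) : f.natDegree ≤ l :=
      natDegree_le_of_degree_le (Order.le_of_lt_succ hf)
    obtain ⟨c, rfl, rfl⟩ := hmatch f g (hnat hf) (hnat hg) fun j _ => hfg j
    rfl
  · exact eq_of_not_cycleBound hα hk p hp hI hJ hcyc hf hg hfg

theorem IsPowConstruction.separatesPolys {e p : ℕ} [Fact p.Prime] [Algebra (ZMod p) F] {γ : F}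
    (h : IsPowConstruction k e n p F γ) (hk : 1 ≤ k) (he : (2 * k - 1)! ^ 2 ≤ e) :
    SeparatesPolys k (2 * k - 1) (powPoints γ e n) := by
  refine (h.sparselyIndependent_powPoints he).separatesPolys hk p (lt_of_le_of_lt ?_ h.lt_prime)
  calc 2 * k - 1 ≤ (2 * k - 1)! := Nat.self_le_factorial _
    _ ≤ (2 * k - 1)! ^ 2 := Nat.le_self_pow two_ne_zero _
    _ ≤ e := he
    _ ≤ k ^ 2 * e := Nat.le_mul_of_pos_left _ (pow_pos hk 2)

end Separation

section PermInsdel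

variable {A : Type*}

theorem InsdelErrors.exists_common {m : ℕ} {s w : List A} (h : InsdelErrors m s w) :
    ∃ Z : Multiset A, Z ≤ s ∧ Z ≤ w ∧ s.length + w.length ≤ m + 2 * Z.card := by
  classical
  induction m generalizing s with
  | zero =>
    obtain rfl : s = w := h
    exact ⟨s, le_rfl, le_rfl, by simp; omega⟩
  | succ m ih =>
    obtain ⟨u, hstep, hu⟩ := h
    obtain ⟨Z, hZu, hZw, hZ⟩ := ih hu
    cases hstep with
    | deletion l r a =>
      refine ⟨Z, hZu.trans ?_, hZw, ?_⟩
      · rw [← Multiset.coe_add, ← Multiset.coe_add, ← Multiset.cons_coe]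
        exact add_le_add le_rfl (Multiset.le_cons_self _ _)
      · simp only [List.length_append, List.length_cons] at hZ ⊢
        omega
    | insertion l r a =>
      refine ⟨Z.erase a, ?_, (Multiset.erase_le a Z).trans hZw, ?_⟩
      · rw [Multiset.erase_le_iff_le_cons, ← Multiset.coe_add, ← Multiset.add_cons,
          Multiset.cons_coe, Multiset.coe_add]
        exact hZu
      · have herase : Z.card ≤ (Z.erase a).card + 1 := by
          rw [← Multiset.card_cons a]
          exact Multiset.card_le_card (Multiset.le_cons_erase Z a)
        simp only [List.length_append, List.length_cons] at hZ ⊢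
        omega

theorem exists_injective_of_le_map {ι : Type*} (c : ι → A) (L : List A)
    (s : Finset ι) (h : (L : Multiset A) ≤ s.val.map c) :
    ∃ I : Fin L.length → ι, Function.Injective I ∧ (∀ j, I j ∈ s) ∧ ∀ j, c (I j) = L.get j := by
  classical
  induction L generalizing s with
  | nil => exact ⟨fun j => j.elim0, fun j => j.elim0, fun j => j.elim0, fun j => j.elim0⟩
  | cons x L ih =>
    rw [← Multiset.cons_coe] at h
    have hx : x ∈ s.val.map c := Multiset.mem_of_le h (Multiset.mem_cons_self _ _)
    obtain ⟨i, hi, rfl⟩ := Multiset.mem_map.mp hx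
    have hs : s.val = i ::ₘ (s.erase i).val := by
      rw [Finset.erase_val, Multiset.cons_erase hi]
    rw [hs, Multiset.map_cons, Multiset.cons_le_cons_iff] at h
    obtain ⟨I, hI, hIs, hIc⟩ := ih _ h
    refine ⟨Fin.cons i I, Fin.cons_injective_iff.mpr ⟨?_, hI⟩, ?_, ?_⟩
    · rintro ⟨j, hj⟩
      exact Finset.ne_of_mem_erase (hIs j) hj
    · exact Fin.cases hi fun j => Finset.mem_of_mem_erase (hIs j)
    · exact Fin.cases rfl hIc

theorem exists_matching_of_mem_adversaryOutputs {n t r : ℕ} (hrt : r + t ≤ n)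
    {c c' : Fin n → A} {w : List A} (h : w ∈ adversaryOutputs t c)
    (h' : w ∈ adversaryOutputs t c') : ∃ I J : Fin r → Fin n, Function.Injective I ∧
      Function.Injective J ∧ ∀ j, c (I j) = c' (J j) := by
  classical
  obtain ⟨π, m, hm, hw⟩ := h
  obtain ⟨π', m', hm', hw'⟩ := h'
  obtain ⟨Z, hZs, hZw, hZ⟩ := hw.exists_common
  obtain ⟨Z', hZs', hZw', hZ'⟩ := hw'.exists_common
  rw [List.length_ofFn] at hZ hZ'
  -- `Z` and `Z'` both lie in `w`, so inclusion-exclusion makes their intersection large.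
  have hunion : (Z ∪ Z').card ≤ w.length := Multiset.card_le_card (Multiset.union_le hZw hZw')
  have hinter := congrArg Multiset.card (Multiset.union_add_inter Z Z')
  rw [Multiset.card_add, Multiset.card_add] at hinter
  set L := (Z ∩ Z').toList with hL
  have hLr : r ≤ L.length := by rw [hL, Multiset.length_toList]; omega
  obtain ⟨I, hI, -, hIc⟩ := exists_injective_of_le_map (fun i => c (π i)) L Finset.univ
    (by rw [hL, Multiset.coe_toList, Fin.univ_val_map]; exact Multiset.inter_le_left.trans hZs)
  obtain ⟨J, hJ, -, hJc⟩ := exists_injective_of_le_map (fun i => c' (π' i)) L Finset.univ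
    (by rw [hL, Multiset.coe_toList, Fin.univ_val_map]; exact Multiset.inter_le_right.trans hZs')
  exact ⟨fun j => π (I (Fin.castLE hLr j)), fun j => π' (J (Fin.castLE hLr j)),
    π.injective.comp (hI.comp (Fin.castLE_injective hLr)),
    π'.injective.comp (hJ.comp (Fin.castLE_injective hLr)), fun j => (hIc _).trans (hJc _).symm⟩

theorem SeparatesPolys.robustPermInsdel_rsCode {F : Type*} [Field F] {n k r t : ℕ} {α : Fin n → F}
    (h : SeparatesPolys k r α) (hrt : r + t ≤ n) : RobustPermInsdel t (rsCode k α) := by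
  rintro c ⟨f, hf, rfl⟩ c' ⟨g, hg, rfl⟩ hne
  refine Set.disjoint_left.mpr fun w hw hw' => hne ?_
  obtain ⟨I, J, hI, hJ, hIJ⟩ := exists_matching_of_mem_adversaryOutputs hrt hw hw'
  rw [h f g hf hg I J hI hJ hIJ]

end PermInsdel

section UniformFibers

variable {G H : Type*} [AddGroup G] [Fintype G] [AddGroup H] [Fintype H]

theorem card_fiber_mul_card [DecidableEq H] (f : G →+ H) (hf : Function.Surjective f) (x : H) :
    (Finset.univ.filter fun g => f g = x).card * Fintype.card H = Fintype.card G := by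
  have hsum := Finset.card_eq_sum_card_fiberwise (f := f) (s := Finset.univ) (t := Finset.univ)
    fun _ _ => Finset.mem_coe.mpr (Finset.mem_univ _)
  rw [Finset.sum_congr rfl fun y _ => AddMonoidHom.card_fiber_eq_of_mem_range f (hf y) (hf x),
    Finset.sum_const, smul_eq_mul, Finset.card_univ, Finset.card_univ] at hsum
  rw [hsum, mul_comm]

theorem toOuterMeasure_uniformOfFintype_fiber (f : G →+ H) (hf : Function.Surjective f) (x : H) :
    (PMF.uniformOfFintype G).toOuterMeasure {g | f g = x} = (Fintype.card H : ℝ≥0∞)⁻¹ := by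
  classical
  have hcard : Fintype.card {g | f g = x} = (Finset.univ.filter fun g => f g = x).card :=
    Fintype.card_of_subtype _ fun g => by simp
  have hne : ((Finset.univ.filter fun g => f g = x).card : ℝ≥0∞) ≠ 0 := by
    obtain ⟨g, hg⟩ := hf x
    exact Nat.cast_ne_zero.mpr (Finset.card_ne_zero.mpr ⟨g, by simpa using hg⟩)
  rw [PMF.toOuterMeasure_uniformOfFintype_apply, ← card_fiber_mul_card f hf x, hcard, Nat.cast_mul]
  nth_rewrite 1 [← mul_one (Nat.cast _)]
  rw [ENNReal.mul_div_mul_left _ _ hne (ENNReal.natCast_ne_top _), one_div]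

end UniformFibers

section Shamir

variable {F : Type*} [Field F] {n k r : ℕ} {α : Fin n → F}

theorem exists_sum_mul_pow_succ_eq {m l : ℕ} (hm : m ≤ l) {β : Fin m → F}
    (hβ : Function.Injective β) (hβ0 : ∀ j, β j ≠ 0) (v : Fin m → F) :
    ∃ a : Fin l → F, ∀ j, ∑ i, a i * β j ^ ((i : ℕ) + 1) = v j := by
  set g := Lagrange.interpolate Finset.univ β fun j => v j / β j
  have hdeg : g.degree < l :=
    (Lagrange.degree_interpolate_lt _ hβ.injOn).trans_le (by simpa using hm)
  refine ⟨fun i => g.coeff i, fun j => ?_⟩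
  have heval : g.eval (β j) = ∑ i : Fin l, g.coeff i * β j ^ (i : ℕ) := by
    rw [eval_eq_sum_degreeLTEquiv (mem_degreeLT.mpr hdeg)]
    rfl
  calc ∑ i : Fin l, g.coeff i * β j ^ ((i : ℕ) + 1) = g.eval (β j) * β j := by
        simp only [heval, Finset.sum_mul, pow_succ, mul_assoc]
    _ = v j := by
        rw [Lagrange.eval_interpolate_at_node _ hβ.injOn (Finset.mem_univ j),
          div_mul_cancel₀ _ (hβ0 j)]

theorem SeparatesPolys.exists_decoder (h : SeparatesPolys k r α) :
    ∃ dec : (Fin r → F) → F[X], ∀ f : F[X], f.degree < k → ∀ I : Fin r → Fin n,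
      Function.Injective I → dec (fun j => f.eval (α (I j))) = f := by
  let observe : degreeLT F k × (Fin r ↪ Fin n) → Fin r → F := fun x j => x.1.1.eval (α (x.2 j))
  have hfactor : Function.FactorsThrough (fun x => (x.1 : F[X])) observe := fun x y hxy =>
    h _ _ (mem_degreeLT.mp x.1.2) (mem_degreeLT.mp y.1.2) _ _ x.2.injective y.2.injective
      (congrFun hxy)
  exact ⟨Function.extend observe (fun x => x.1) 0, fun f hf I hI =>
    hfactor.extend_apply 0 (⟨f, mem_degreeLT.mpr hf⟩, ⟨I, hI⟩)⟩

variable [Fintype F]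

theorem toOuterMeasure_shamirShare (hα : Function.Injective α) (hα0 : ∀ i, α i ≠ 0) (s : F)
    {m : ℕ} (hm : m ≤ k - 1) {I : Fin m → Fin n} (hI : Function.Injective I) (v : Fin m → F) :
    (shamirShare k α s).toOuterMeasure {sh | (fun j => sh (I j)) = v}
      = ((Fintype.card F : ℝ≥0∞)⁻¹) ^ m := by
  let Λ : (Fin (k - 1) → F) →+ (Fin m → F) :=
    { toFun := fun a j => ∑ i, a i * α (I j) ^ ((i : ℕ) + 1)
      map_zero' := by ext; simp
      map_add' := fun a b => by ext; simp [add_mul, Finset.sum_add_distrib] }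
  have hΛ : Function.Surjective Λ := fun w => by
    obtain ⟨a, ha⟩ := exists_sum_mul_pow_succ_eq hm (hα.comp hI) (fun j => hα0 (I j)) w
    exact ⟨a, funext ha⟩
  have hpreimage : (fun (a : Fin (k - 1) → F) (i : Fin n) =>
      (C s + ∑ j : Fin (k - 1), C (a j) * X ^ ((j : ℕ) + 1)).eval (α i)) ⁻¹'
        {sh | (fun j => sh (I j)) = v} = {a | Λ a = fun j => v j - s} := by
    ext a
    simp only [Set.mem_preimage, Set.mem_ofPred_eq, funext_iff]
    refine forall_congr' fun j => ?_
    simp only [eval_add, eval_C, eval_finsetSum, eval_mul, eval_pow, eval_X]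
    rw [eq_sub_iff_add_eq, add_comm]
    rfl
  rw [shamirShare, PMF.toOuterMeasure_map_apply, hpreimage,
    toOuterMeasure_uniformOfFintype_fiber Λ hΛ, Fintype.card_fun, Fintype.card_fin, Nat.cast_pow,
    ENNReal.inv_pow]

theorem exists_eval_eq_of_mem_support_shamirShare (hk : 1 ≤ k) {s : F} {sh : Fin n → F}
    (hsh : sh ∈ (shamirShare k α s).support) :
    ∃ f : F[X], f.degree < k ∧ f.coeff 0 = s ∧ sh = fun i => f.eval (α i) := by
  obtain ⟨a, -, rfl⟩ := (PMF.mem_support_map_iff _ _ _).mp hsh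
  refine ⟨_, ?_, by simp [finsetSum_coeff], rfl⟩
  have hsum : (∑ j : Fin (k - 1), C (a j) * X ^ ((j : ℕ) + 1)).degree < (k : WithBot ℕ) := by
    refine (degree_sum_le _ _).trans_lt ((Finset.sup_lt_iff (WithBot.bot_lt_coe k)).mpr ?_)
    exact fun j _ => (degree_C_mul_X_pow_le _ _).trans_lt
      (Nat.cast_lt.mpr (Nat.add_lt_of_lt_sub j.2))
  exact (degree_add_le _ _).trans_lt
    (max_lt (degree_C_le.trans_lt (by exact_mod_cast hk)) hsum)

theorem SeparatesPolys.isFullyAnonymousRamp_shamirShare (h : SeparatesPolys k r α)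
    (hα : Function.Injective α) (hα0 : ∀ i, α i ≠ 0) (hk : 1 ≤ k) (hkr : k ≤ r) (hrn : r ≤ n) :
    IsFullyAnonymousRamp (k - 1) r n (shamirShare k α) where
  gap := Nat.sub_one_lt_of_le hk hkr
  threshold_le := hrn
  share_anonymity s m hm I hI v := toOuterMeasure_shamirShare hα hα0 s hm hI v
  anonymous_recon := by
    obtain ⟨dec, hdec⟩ := h.exists_decoder
    refine ⟨fun y => (dec y).coeff 0, fun s I hI sh hsh => ?_⟩
    obtain ⟨f, hf, hfs, rfl⟩ := exists_eval_eq_of_mem_support_shamirShare hk hsh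
    exact (congrArg (coeff · 0) (hdec f hf I hI)).trans hfs

end Shamir

section Parameters

variable {k e n p : ℕ}

theorem IsPowConstruction.card_eq_pow [Fact p.Prime] {F : Type*} [Field F] [Fintype F]
    [Algebra (ZMod p) F] {γ : F} (h : IsPowConstruction k e n p F γ) :
    Fintype.card F = p ^ (k ^ 2 * e) := by
  rw [Module.card_eq_pow_finrank (K := ZMod p), h.finrank_eq, ZMod.card]

-- The factor `2` matters only for `k = 1`: nonzero points need a field of degree `k² e > 1`.
theorem IsPowConstruction.powPoints_spec [Fact p.Prime] {F : Type*} [Field F] [Fintype F]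
    [Algebra (ZMod p) F] {γ : F} (h : IsPowConstruction k e n p F γ) (hk : 1 ≤ k)
    (hkn : 2 * k - 1 ≤ n) (he : 2 * (2 * k - 1)! ^ 2 ≤ e) :
    Function.Injective (powPoints γ e n) ∧ (∀ i, powPoints γ e n i ≠ 0) ∧
      RobustPermInsdel (n + 1 - 2 * k) (rsCode k (powPoints γ e n)) ∧
      IsFullyAnonymousRamp (k - 1) (2 * k - 1) n (shamirShare k (powPoints γ e n)) := by
  have hfactorial : 0 < (2 * k - 1)! ^ 2 := pow_pos (Nat.factorial_pos _) 2
  have hdegree : e ≤ k ^ 2 * e := Nat.le_mul_of_pos_left _ (pow_pos hk 2)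
  have hinj : Function.Injective (powPoints γ e n) := h.powPoints_injective hk (by omega)
  have hne : ∀ i, powPoints γ e n i ≠ 0 := h.powPoints_ne_zero (by omega)
  have hsep : SeparatesPolys k (2 * k - 1) (powPoints γ e n) := h.separatesPolys hk (by omega)
  exact ⟨hinj, hne, hsep.robustPermInsdel_rsCode (by omega),
    hsep.isFullyAnonymousRamp_shamirShare hinj hne hk (by omega) hkn⟩

theorem exists_isPowConstruction_of_le_pow {A : ℕ} (hn : 2 ≤ n) (he : 1 < k ^ 2 * e)
    (hA : k ^ 2 * e ≤ n ^ A) :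
    ∃ (p : ℕ) (_ : Fact p.Prime) (F : Type) (_ : Field F) (_ : Fintype F)
      (_ : Algebra (ZMod p) F) (γ : F), IsPowConstruction k e n p F γ ∧
        Fintype.card F ≤ n ^ (2 * A * (k ^ 2 * e)) := by
  have hA0 : A ≠ 0 := by
    rintro rfl
    exact he.not_ge hA
  obtain ⟨p, hp, hlt, hle⟩ := Nat.exists_prime_lt_and_le_two_mul (max n (k ^ 2 * e)) (by omega)
  have : Fact p.Prime := ⟨hp⟩
  have hpn : p ≤ n ^ (2 * A) :=
    calc p ≤ 2 * max n (k ^ 2 * e) := hle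
      _ ≤ n * n ^ A := Nat.mul_le_mul hn (max_le (Nat.le_self_pow hA0 n) hA)
      _ = n ^ (A + 1) := (pow_succ' n A).symm
      _ ≤ n ^ (2 * A) := Nat.pow_le_pow_right (by omega) (by omega)
  obtain ⟨γ, hγ⟩ := Field.exists_primitive_element (ZMod p) (GaloisField p (k ^ 2 * e))
  have : Fintype (GaloisField p (k ^ 2 * e)) := Fintype.ofFinite _
  have h : IsPowConstruction k e n p (GaloisField p (k ^ 2 * e)) γ :=
    ⟨(le_max_right _ _).trans_lt hlt, (le_max_left _ _).trans hlt.le,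
      GaloisField.finrank p (by omega), hγ⟩
  refine ⟨p, inferInstance, _, inferInstance, inferInstance, inferInstance, γ, h, ?_⟩
  rw [h.card_eq_pow, pow_mul n (2 * A)]
  exact Nat.pow_le_pow_left hpn _

theorem ell_eq (hk : 1 ≤ k) : ell k = 2 * k ^ 2 * (2 * (2 * k - 1)! ^ 2) := by
  rw [ell, ← Nat.mul_factorial_pred (by omega : 2 * k ≠ 0)]
  ring

theorem two_mul_sq_factorial_le_ell (hk : 1 ≤ k) : 2 * (2 * k - 1)! ^ 2 ≤ ell k := by
  rw [ell_eq hk]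
  exact Nat.le_mul_of_pos_left _ (by positivity)

theorem one_lt_sq_mul (hk : 1 ≤ k) (he : 2 * (2 * k - 1)! ^ 2 ≤ e) : 1 < k ^ 2 * e := by
  have : 0 < (2 * k - 1)! ^ 2 := pow_pos (Nat.factorial_pos _) 2
  have : e ≤ k ^ 2 * e := Nat.le_mul_of_pos_left _ (pow_pos hk 2)
  omega

theorem sq_mul_two_mul_sq_factorial_le_pow (hk : 1 ≤ k) (hn : 2 ≤ n) (hkn : 2 * k - 1 ≤ n) :
    k ^ 2 * (2 * (2 * k - 1)! ^ 2) ≤ n ^ (4 * k + 1) := by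
  have hfactorial : (2 * k - 1)! ≤ n ^ (2 * k - 1) :=
    (Nat.factorial_le_pow _).trans (Nat.pow_le_pow_left hkn _)
  calc k ^ 2 * (2 * (2 * k - 1)! ^ 2)
      ≤ n ^ 2 * (n * (n ^ (2 * k - 1)) ^ 2) := by gcongr; omega
    _ = n ^ (2 + (1 + (2 * k - 1) * 2)) := by rw [← pow_mul, ← pow_succ', ← pow_add]; ring
    _ = n ^ (4 * k + 1) := by congr 1; omega

theorem exists_isPowConstruction_le_pow_ell (hk : 1 ≤ k) (hn : 2 ≤ n) (hkn : 2 * k - 1 ≤ n) :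
    ∃ (p : ℕ) (_ : Fact p.Prime) (F : Type) (_ : Field F) (_ : Fintype F)
      (_ : Algebra (ZMod p) F) (γ : F),
      IsPowConstruction k (2 * (2 * k - 1)! ^ 2) n p F γ ∧
        Fintype.card F ≤ n ^ (5 * (k ^ 2 * ell k)) := by
  obtain ⟨p, hp, F, _, _, _, γ, h, hcard⟩ := exists_isPowConstruction_of_le_pow hn
    (one_lt_sq_mul hk le_rfl) (sq_mul_two_mul_sq_factorial_le_pow hk hn hkn)
  refine ⟨p, hp, F, _, _, _, γ, h, hcard.trans (Nat.pow_le_pow_right (by omega) ?_)⟩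
  rw [ell_eq hk]
  calc 2 * (4 * k + 1) * (k ^ 2 * (2 * (2 * k - 1)! ^ 2))
      ≤ 5 * (2 * k ^ 2) * (k ^ 2 * (2 * (2 * k - 1)! ^ 2)) :=
        Nat.mul_le_mul_right _ (by nlinarith)
    _ = 5 * (k ^ 2 * (2 * k ^ 2 * (2 * (2 * k - 1)! ^ 2))) := by ring

end Parameters

/-- Part 1: every instance of the construction with exponent `ℓ = ((2k)!)²` yields distinct nonzero
points, a robust Reed–Solomon code and a fully anonymous ramp scheme. Part 2: an instance exists
over a field of size at most `n ^ (c * A * k² ℓ)` as soon as `k² ℓ ≤ n ^ A`, with `c` absolute.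
Part 3: for all `k, n` a field of size at most `n ^ (c * k² ℓ)`, with `c` absolute, is reached by
the same kind of points `(γ - i) ^ e` with some exponent `e ≤ ℓ`. -/
theorem mainTheorem3 :
    (∀ (k n p : ℕ) [Fact p.Prime] (F : Type*) [Field F] [Fintype F] [Algebra (ZMod p) F] (γ : F),
      1 ≤ k → 2 * k - 1 ≤ n → IsPowConstruction k (ell k) n p F γ →
        Fintype.card F = p ^ (k ^ 2 * ell k) ∧
        Function.Injective (powPoints γ (ell k) n) ∧
        (∀ i, powPoints γ (ell k) n i ≠ 0) ∧
        RobustPermInsdel (n + 1 - 2 * k) (rsCode k (powPoints γ (ell k) n)) ∧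
        IsFullyAnonymousRamp (k - 1) (2 * k - 1) n (shamirShare k (powPoints γ (ell k) n))) ∧
    (∃ c : ℕ, ∀ A k n : ℕ, 1 ≤ k → 2 ≤ n → 2 * k - 1 ≤ n → k ^ 2 * ell k ≤ n ^ A →
      ∃ (p : ℕ) (_ : Fact p.Prime) (F : Type) (_ : Field F) (_ : Fintype F)
        (_ : Algebra (ZMod p) F) (γ : F),
        IsPowConstruction k (ell k) n p F γ ∧
        Fintype.card F ≤ n ^ (c * A * (k ^ 2 * ell k))) ∧
    (∃ c : ℕ, ∀ k n : ℕ, 1 ≤ k → 2 ≤ n → 2 * k - 1 ≤ n →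
      ∃ (e p : ℕ) (_ : Fact p.Prime) (F : Type) (_ : Field F) (_ : Fintype F)
        (_ : Algebra (ZMod p) F) (γ : F),
        e ≤ ell k ∧ IsPowConstruction k e n p F γ ∧
        Fintype.card F ≤ n ^ (c * (k ^ 2 * ell k)) ∧
        Function.Injective (powPoints γ e n) ∧
        (∀ i, powPoints γ e n i ≠ 0) ∧
        RobustPermInsdel (n + 1 - 2 * k) (rsCode k (powPoints γ e n)) ∧
        IsFullyAnonymousRamp (k - 1) (2 * k - 1) n (shamirShare k (powPoints γ e n))) := by
  refine ⟨fun k n p _ F _ _ _ γ hk hkn h => ?_, ⟨2, fun A k n hk hn hkn hA => ?_⟩,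
    ⟨5, fun k n hk hn hkn => ?_⟩⟩
  · exact ⟨h.card_eq_pow, h.powPoints_spec hk hkn (two_mul_sq_factorial_le_ell hk)⟩
  · exact exists_isPowConstruction_of_le_pow hn
      (one_lt_sq_mul hk (two_mul_sq_factorial_le_ell hk)) hA
  · obtain ⟨p, hp, F, _, _, _, γ, h, hcard⟩ := exists_isPowConstruction_le_pow_ell hk hn hkn
    exact ⟨_, p, hp, F, _, _, _, γ, two_mul_sq_factorial_le_ell hk, h, hcard,
      h.powPoints_spec hk hkn le_rfl⟩
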